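/- **Model.** Base stations (BSs) in the plane, seen from a typical user at the origin, form two independent Poisson point processes $\Phi_L$ (LOS) and $\Phi_N$ (NLOS), with intensities $\lambda_{BS}\,p_{LOS}\mathbf 1\{\|x\|\le D\}$ and $\lambda_{BS}(1-p_{LOS})\mathbf 1\{\|x\|\le D\}+\lambda_{BS}\mathbf 1\{\|x\|>D\}$, where $\lambda_{BS},D>0$ and $0<p_{LOS}\le1$. The path loss from a BS at $x$ of type $j\in\{L,N\}$ is $L=10^{(\beta+10\alpha_j\log_{10}\|x\|+S)/10}$ with $\beta=20\log_{10}(4\pi/\lambda_c)$ and independent shadowing $S\sim N(0,\xi_j^2)$, $\alpha_j,\xi_j,\lambda_c>0$. Each link of type $j$ has $\eta_j\ge1$ paths with i.i.d. circularly symmetric complex normal gains $\gamma_k$ of mean zero and unit variance. The user associates with the BS of minimum path loss. The number $N\ge 1$ of users of that BS is modelled as an independent variable with $$\kappa(n)=\frac{3.5^{3.5}}{(n-1)!}\frac{\Gamma(n+3.5)}{\Gamma(3.5)}\rho^{n-1}(3.5+\rho)^{-n-3.5}\quad(n\ge1),\qquad \rho=\lambda_{UE}/\lambda_{BS}>0,$$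 and the BS sends $U=\min(U_M,N)$ streams, $U_M\ge1$. With $G=P\,N_{BS}N_{UE}$ (transmit power $P>0$, antenna numbers $N_{BS},N_{UE}\ge1$, noise power $\sigma_n^2>0$), the SNR is modelled as $$\mathrm{SNR}=\frac{G}{\eta_jU\sigma_n^2}\,\max_k|\gamma_k|^2\,L^{-1}\,p,$$ where $j$, $L$, $\gamma_k$ refer to the serving BS, and the zero-forcing penalty $p=p_{j,U}$ is taken from a family $(p_{j,u})_{j,u}$ that is independent of everything else. Its reference law is Bernoulli with success probability $$\zeta(\eta_j,U)=\sum_{i=1}^{N_{BS}}q_{BS,i}B_i(\eta_j,U)\bigl(p_{LOS}A_i(\eta_L)+(1-p_{LOS})A_i(\eta_N)\bigr)^{U-1},$$ where, for $a\in\{BS,UE\}$, $q_{a,i}=\bigl(\arcsin(-1+\tfrac{2i+1}{N_a})-\arcsin(-1+\tfrac{2i-1}{N_a})\bigr)/\pi$ for $1\le i<N_a$ and $q_{a,N_a}=1-\sum_{i<N_a}q_{a,i}$; $C(\eta)=\sum_{i=1}^{N_{UE}} q_{UE,i}(1-q_{UE,i})^{\eta-1}$; $A_i(\eta)=C(\eta)+(1-q_{BS,i})^{\eta-1}-(1-q_{BS,i})^{\eta-1}C(\eta)$;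 $B_i(\eta,U)=C(\eta)(1-q_{BS,i})^{U-1}+D_i(\eta,U)-D_i(\eta,U)C(\eta)$; $$D_i(\eta,U)=\sum_{i_1,\dots,i_{\eta-1}=1}^{N_{BS}-1}\Bigl(\prod_{n=1}^{\eta-1}l_{i_n,i}\Bigr)\Bigl(1-\sum_{v\in\{i_1,\dots,i_{\eta-1}\}}l_{v,i}\Bigr)^{U-1},$$ with $l_{n,i}=q_{BS,n}/(1-q_{BS,i})$ if $n<i$ and $l_{n,i}=q_{BS,n+1}/(1-q_{BS,i})$ if $n\ge i$. **Notation.** Let $Q$ be the standard Gaussian tail, $m=-0.1\beta\ln10$, $\sigma_j=0.1\xi_j\ln10$, $\Upsilon_j(t)=(\ln(D^{\alpha_j}/t)-m)/\sigma_j$, $E_j=\exp(2\sigma_j^2/\alpha_j^2+2m/\alpha_j)$, $$M_L(t)=\pi p_{LOS}\bigl[D^2Q(\Upsilon_L(t))+t^{2/\alpha_L}E_L\,Q(2\sigma_L/\alpha_L-\Upsilon_L(t))\bigr],$$ $$M_N(t)=-\pi p_{LOS}D^2Q(\Upsilon_N(t))+\pi t^{2/\alpha_N}E_N\bigl[1-p_{LOS}Q(2\sigma_N/\alpha_N-\Upsilon_N(t))\bigr],$$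 $B_L=1-\exp(-\lambda_{BS}\pi p_{LOS}D^2)$, $B_N=1$, $f_j(t)=\lambda_{BS}e^{-\lambda_{BS}M_j(t)}M_j'(t)/B_j$, and let $\bar j$ be the type other than $j$. For $\tau\ge0$ and $1\le u\le U_M$ put $S(\tau,u)=\mathbb P(\mathrm{SNR}>\tau\mid U=u)$ and $$\widehat S(\tau,u)=\sum_{j\in\{L,N\}}B_j\,\zeta(\eta_j,u)\sum_{n=1}^{\eta_j}(-1)^{n+1}\binom{\eta_j}{n}\int_0^\infty\exp\Bigl(-\frac{\eta_j\tau n u\,l\,\sigma_n^2}{G}-\lambda_{BS}M_{\bar j}(l)\Bigr)f_j(l)\,dl.$$ **Theorem.** Let $\tau\ge0$. Almost surely exactly one BS has minimum path loss; the number of streams has the probability mass function $\mathbb P(U=n)=\kappa(n)$ for $1\le n<U_M$ and $\mathbb P(U=U_M)=1-\sum_{i=1}^{U_M-1}\kappa(i)$; and the SNR coverage of the typical user is $$\mathbb P(\mathrm{SNR}>\tau)=\mathbb E_U[S(\tau,U)]=\sum_{u=1}^{U_M}\mathbb P(U=u)\,S(\tau,u).$$ All integrals in $\widehat S$ converge,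 and for every $1\le u\le U_M$: (i) if $p_{j,u}$ is Bernoulli with success probability $\zeta(\eta_j,u)$ for both $j$, then $S(\tau,u)=\widehat S(\tau,u)$; (ii) if $p_{j,u}$ only stochastically dominates that Bernoulli variable for both $j$, then $S(\tau,u)\ge\widehat S(\tau,u)$. -/

import Mathlib

open MeasureTheory ProbabilityTheory Set

noncomputable section

namespace MmWave

/-- Type of a link: line of sight (LOS) or non line of sight (NLOS). -/
inductive LinkType
  | LOS
  | NLOS

instance : Inhabited LinkType := ⟨LinkType.LOS⟩

/-- The other link type. -/
def LinkType.other : LinkType → LinkType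
  | .LOS => .NLOS
  | .NLOS => .LOS

/-- Deterministic parameters of the network, with their ranges. -/
structure Params where
  /-- base station (BS) density -/
  lamBS : ℝ
  /-- user (UE) density -/
  lamUE : ℝ
  /-- carrier wavelength -/
  wavelength : ℝ
  /-- path loss exponents -/
  alpha : LinkType → ℝ
  /-- standard deviations (in dB) of the shadowing -/
  xi : LinkType → ℝ
  /-- probability that a link of length at most `D` is LOS -/
  pLOS : ℝ
  /-- maximal length of a LOS link -/
  D : ℝ
  /-- number of propagation paths of a link -/
  eta : LinkType → ℕ
  /-- number of antennas at a BS -/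
  NBS : ℕ
  /-- number of antennas at a UE -/
  NUE : ℕ
  /-- maximal number of users that a BS schedules in a time slot -/
  UM : ℕ
  /-- transmit power of a BS -/
  power : ℝ
  /-- noise power `σ_n ^ 2` -/
  noise : ℝ
  lamBS_pos : 0 < lamBS
  lamUE_pos : 0 < lamUE
  wavelength_pos : 0 < wavelength
  alpha_pos : ∀ j, 0 < alpha j
  xi_pos : ∀ j, 0 < xi j
  pLOS_pos : 0 < pLOS
  pLOS_le_one : pLOS ≤ 1
  D_pos : 0 < D
  eta_pos : ∀ j, 1 ≤ eta j
  NBS_pos : 1 ≤ NBS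
  NUE_pos : 1 ≤ NUE
  UM_pos : 1 ≤ UM
  power_pos : 0 < power
  noise_pos : 0 < noise

/-! ### Zero-forcing penalty -/

/-- Probability of the `i`-th quantized virtual angle, `1 ≤ i < N`. -/
def angleProbAux (N i : ℕ) : ℝ :=
  (Real.arcsin (-1 + (2 * i + 1) / N) - Real.arcsin (-1 + (2 * i - 1) / N)) / Real.pi

/-- Distribution `q_i`, `1 ≤ i ≤ N`, of the quantized virtual angle for an array of size `N`. -/
def angleProb (N i : ℕ) : ℝ :=
  if i < N then angleProbAux N i else 1 - ∑ j ∈ Finset.Icc 1 (N - 1), angleProbAux N j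

/-- `C(η) = ∑ᵢ q_{UE,i} (1 - q_{UE,i}) ^ (η - 1)`. -/
def zfC (NUE η : ℕ) : ℝ :=
  ∑ i ∈ Finset.Icc 1 NUE, angleProb NUE i * (1 - angleProb NUE i) ^ (η - 1)

/-- `A_j(η)`. -/
def zfA (NBS NUE j η : ℕ) : ℝ :=
  zfC NUE η + (1 - angleProb NBS j) ^ (η - 1) - (1 - angleProb NBS j) ^ (η - 1) * zfC NUE η

/-- `l_{n,j}`: the angle distribution with the `j`-th value removed, renumbered and normalized. -/
def zfl (NBS n j : ℕ) : ℝ :=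
  if n < j then angleProb NBS n / (1 - angleProb NBS j)
  else angleProb NBS (n + 1) / (1 - angleProb NBS j)

/-- `D_j(η, U)`. The tuples `(i_1, …, i_{η-1})` with entries in `{1, …, N_BS - 1}` are indexed by
functions `i : Fin (η - 1) → Fin (N_BS - 1)`, the entries being `i n + 1`. The inner sum is over
the distinct values of the tuple. -/
def zfD (NBS j η U : ℕ) : ℝ :=
  ∑ i : Fin (η - 1) → Fin (NBS - 1),
    (∏ n, zfl NBS ((i n : ℕ) + 1) j) *
      (1 - ∑ v ∈ Finset.univ.image i, zfl NBS ((v : ℕ) + 1) j) ^ (U - 1)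

/-- `B_j(η, U)`. -/
def zfB (NBS NUE j η U : ℕ) : ℝ :=
  zfC NUE η * (1 - angleProb NBS j) ^ (U - 1) + zfD NBS j η U - zfD NBS j η U * zfC NUE η

/-- `ζ(η, U)`: the success probability of the zero-forcing penalty `p_MU`. -/
def Params.zeta (P : Params) (η U : ℕ) : ℝ :=
  ∑ j ∈ Finset.Icc 1 P.NBS, angleProb P.NBS j * zfB P.NBS P.NUE j η U *
    (P.pLOS * zfA P.NBS P.NUE j (P.eta .LOS) +
      (1 - P.pLOS) * zfA P.NBS P.NUE j (P.eta .NLOS)) ^ (U - 1)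

/-- The Bernoulli law on `ℝ` with success probability `p`. -/
def bernoulliLaw (p : ℝ) : Measure ℝ :=
  ENNReal.ofReal p • Measure.dirac 1 + ENNReal.ofReal (1 - p) • Measure.dirac 0

/-- `ν₁` stochastically dominates `ν₂`. -/
def StochDominates (ν₁ ν₂ : Measure ℝ) : Prop :=
  ∀ z : ℝ, ν₂ (Ioi z) ≤ ν₁ (Ioi z)

/-! ### Load -/

/-- `ρ = λ_UE / λ_BS`. -/
def Params.rho (P : Params) : ℝ := P.lamUE / P.lamBS

/-- The probability mass function `κ` of the number of users of the BS serving the typical user. -/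
def Params.kappa (P : Params) (n : ℕ) : ℝ :=
  if n = 0 then 0
  else (3.5 : ℝ) ^ (3.5 : ℝ) / (n - 1).factorial * (Real.Gamma (n + 3.5) / Real.Gamma 3.5) *
    P.rho ^ (n - 1) * (3.5 + P.rho) ^ (-(n : ℝ) - 3.5)

/-- The probability mass function of the number `min U_M N` of multiuser streams. -/
def Params.streamPMF (P : Params) (n : ℕ) : ℝ :=
  (if n < P.UM then P.kappa n else 0) +
    (if n = P.UM then 1 - ∑ i ∈ Finset.Icc 1 (P.UM - 1), P.kappa i else 0)

/-! ### Propagation -/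

/-- `G = P N_BS N_UE`. -/
def Params.G (P : Params) : ℝ := P.power * P.NBS * P.NUE

/-- Reference path loss (in dB) at unit distance. -/
def Params.beta (P : Params) : ℝ := 20 * Real.logb 10 (4 * Real.pi / P.wavelength)

/-- `m = -0.1 β ln 10`. -/
def Params.m (P : Params) : ℝ := -0.1 * P.beta * Real.log 10

/-- `σ_j = 0.1 ξ_j ln 10`. -/
def Params.sigma (P : Params) (j : LinkType) : ℝ := 0.1 * P.xi j * Real.log 10

/-- The Q-function: tail of the standard Gaussian law. -/
def gaussQ (x : ℝ) : ℝ := (gaussianReal 0 1).real (Ioi x)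

/-- `Υ_j(t)`. -/
def Params.upsilon (P : Params) (j : LinkType) (t : ℝ) : ℝ :=
  (Real.log (P.D ^ P.alpha j / t) - P.m) / P.sigma j

/-- `exp (2 σ_j² / α_j² + 2 m / α_j)`. -/
def Params.expFactor (P : Params) (j : LinkType) : ℝ :=
  Real.exp (2 * P.sigma j ^ 2 / P.alpha j ^ 2 + 2 * P.m / P.alpha j)

/-- `M_j(t)`: `λ_BS M_j(t)` is the mean number of BSs of type `j` with path loss below `t`. -/
def Params.M (P : Params) (j : LinkType) (t : ℝ) : ℝ :=
  match j with
  | .LOS => Real.pi * P.pLOS *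
      (P.D ^ 2 * gaussQ (P.upsilon .LOS t) +
        t ^ (2 / P.alpha .LOS) * P.expFactor .LOS *
          gaussQ (2 * P.sigma .LOS ^ 2 / (P.alpha .LOS * P.sigma .LOS) - P.upsilon .LOS t))
  | .NLOS => -Real.pi * P.pLOS * P.D ^ 2 * gaussQ (P.upsilon .NLOS t) +
      Real.pi * t ^ (2 / P.alpha .NLOS) * P.expFactor .NLOS *
        (1 - P.pLOS *
          gaussQ (2 * P.sigma .NLOS ^ 2 / (P.alpha .NLOS * P.sigma .NLOS) - P.upsilon .NLOS t))

/-- `M_j'(t)`, in closed form. -/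
def Params.M' (P : Params) (j : LinkType) (t : ℝ) : ℝ :=
  match j with
  | .LOS => Real.pi * P.pLOS *
      (P.expFactor .LOS * t ^ (2 / P.alpha .LOS - 1) *
          (2 / P.alpha .LOS *
              gaussQ (2 * P.sigma .LOS ^ 2 / (P.alpha .LOS * P.sigma .LOS) - P.upsilon .LOS t) -
            1 / √(2 * Real.pi * P.sigma .LOS ^ 2) *
              Real.exp (-(√2 * P.sigma .LOS / P.alpha .LOS - P.upsilon .LOS t / √2) ^ 2)) +
        P.D ^ 2 / (√(2 * Real.pi) * t * P.sigma .LOS) * Real.exp (-P.upsilon .LOS t ^ 2 / 2))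
  | .NLOS => Real.pi * P.pLOS *
      (P.expFactor .NLOS * t ^ (2 / P.alpha .NLOS - 1) *
          (2 / (P.pLOS * P.alpha .NLOS) -
            2 / P.alpha .NLOS *
              gaussQ (2 * P.sigma .NLOS ^ 2 / (P.alpha .NLOS * P.sigma .NLOS) - P.upsilon .NLOS t) +
            1 / √(2 * Real.pi * P.sigma .NLOS ^ 2) *
              Real.exp (-(√2 * P.sigma .NLOS / P.alpha .NLOS - P.upsilon .NLOS t / √2) ^ 2)) -
        P.D ^ 2 / (√(2 * Real.pi) * t * P.sigma .NLOS) * Real.exp (-P.upsilon .NLOS t ^ 2 / 2))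

/-- `B_j`: the probability that there is at least one BS of type `j`. -/
def Params.B (P : Params) (j : LinkType) : ℝ :=
  match j with
  | .LOS => 1 - Real.exp (-P.lamBS * Real.pi * P.pLOS * P.D ^ 2)
  | .NLOS => 1

/-- `f_j`: the density of the smallest path loss among BSs of type `j`, given there is one. -/
def Params.f (P : Params) (j : LinkType) (t : ℝ) : ℝ :=
  P.lamBS * Real.exp (-P.lamBS * P.M j t) * P.M' j t / P.B j

/-! ### The coverage formula -/

/-- The integrand of the coverage formula. -/
def Params.integrand (P : Params) (τ : ℝ) (U : ℕ) (j : LinkType) (n : ℕ) (l : ℝ) : ℝ :=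
  Real.exp (-(P.eta j * τ * n * U * l * P.noise / P.G) - P.lamBS * P.M j.other l) * P.f j l

/-- The summand of the coverage formula for association with a BS of type `j`. -/
def Params.coverageTerm (P : Params) (τ : ℝ) (U : ℕ) (j : LinkType) : ℝ :=
  P.B j * P.zeta (P.eta j) U *
    ∑ n ∈ Finset.Icc 1 (P.eta j), (-1) ^ (n + 1) * ((P.eta j).choose n : ℝ) *
      ∫ l in Ioi (0 : ℝ), P.integrand τ U j n l

/-- The closed-form expression for the SNR coverage given `U` streams. -/
def Params.coverageFormula (P : Params) (τ : ℝ) (U : ℕ) : ℝ :=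
  P.coverageTerm τ U .LOS + P.coverageTerm τ U .NLOS

/-! ### Poisson point processes -/

section PointProcess

variable {Ω E : Type*} [MeasurableSpace Ω] [MeasurableSpace E]

/-- Number of points in `A` of the point configuration `{X i ω | i < K ω}`. -/
def pointCount (K : Ω → ℕ∞) (X : ℕ → Ω → E) (A : Set E) (ω : Ω) : ℕ∞ :=
  {i : ℕ | (i : ℕ∞) < K ω ∧ X i ω ∈ A}.encard

/-- The point process with (random, possibly infinite) number of points `K` and points `X i`,
`i < K`, is a Poisson point process with intensity measure `Λ`: counts have Poisson laws, and
counts in disjoint sets are independent. -/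
structure IsPoissonPointProcess (K : Ω → ℕ∞) (X : ℕ → Ω → E) (Λ : Measure E) (μ : Measure Ω) :
    Prop where
  measurable_num : Measurable K
  measurable_loc : ∀ i, Measurable (X i)
  map_count : ∀ A, MeasurableSet A → Λ A ≠ ⊤ →
    μ.map (pointCount K X A) =
      (poissonMeasure (Λ A).toNNReal).map (fun n : ℕ => (n : ℕ∞))
  indep_count : ∀ (n : ℕ) (A : Fin n → Set E), (∀ i, MeasurableSet (A i)) →
    Pairwise (fun i k => Disjoint (A i) (A k)) → iIndepFun (fun i => pointCount K X (A i)) μ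

end PointProcess

/-! ### The random network -/

/-- The plane. -/
abbrev Plane := EuclideanSpace ℝ (Fin 2)

open Classical in
/-- Intensity function of the BSs of type `j`, seen from the typical user at the origin. -/
def Params.intensity (P : Params) (j : LinkType) (x : Plane) : ℝ :=
  match j with
  | .LOS => if ‖x‖ ≤ P.D then P.lamBS * P.pLOS else 0
  | .NLOS => if ‖x‖ ≤ P.D then P.lamBS * (1 - P.pLOS) else P.lamBS

/-- Intensity measure of the BSs of type `j`. -/
def Params.intensityMeasure (P : Params) (j : LinkType) : Measure Plane :=
  volume.withDensity (fun x => ENNReal.ofReal (P.intensity j x))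

/-- The circularly symmetric complex normal law with zero mean and unit variance. -/
def complexNormal : Measure ℂ :=
  ((gaussianReal 0 (1 / 2)).prod (gaussianReal 0 (1 / 2))).map (fun z => (⟨z.1, z.2⟩ : ℂ))

/-- The random elements of the network, seen from the typical user at the origin. -/
structure Network (P : Params) (Ω : Type*) where
  /-- number of BSs of type `j` -/
  num : LinkType → Ω → ℕ∞
  /-- location of the `i`-th BS of type `j`; it exists if `i < num j` -/
  loc : LinkType → ℕ → Ω → Plane
  /-- shadowing (in dB) between the typical user and the `i`-th BS of type `j` -/
  shadow : LinkType → ℕ → Ω → ℝ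
  /-- small scale fading on the paths between the typical user and the `i`-th BS of type `j` -/
  fading : (j : LinkType) → ℕ → Fin (P.eta j) → Ω → ℂ
  /-- number of users of the BS serving the typical user -/
  load : Ω → ℕ
  /-- `penalty j U`: zero-forcing penalty on a link of type `j` if the BS sends `U` streams -/
  penalty : LinkType → ℕ → Ω → ℝ

/-- Labels of the independent sources of randomness. -/
inductive Source (P : Params)
  | process (j : LinkType)
  | shadow (j : LinkType) (i : ℕ)
  | fading (j : LinkType) (i : ℕ) (k : Fin (P.eta j))
  | load
  | penalty

namespace Network

variable {P : Params} {Ω : Type*}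

/-- The σ-algebra generated by a source of randomness. -/
@[reducible] def sourceAlgebra (net : Network P Ω) : Source P → MeasurableSpace Ω
  | .process j => MeasurableSpace.comap (net.num j) inferInstance ⊔
      ⨆ i, MeasurableSpace.comap (net.loc j i) inferInstance
  | .shadow j i => MeasurableSpace.comap (net.shadow j i) inferInstance
  | .fading j i k => MeasurableSpace.comap (net.fading j i k) inferInstance
  | .load => MeasurableSpace.comap net.load inferInstance
  | .penalty => ⨆ j, ⨆ u, MeasurableSpace.comap (net.penalty j u) inferInstance

/-- The probabilistic model: independent Poisson processes of LOS and NLOS BSs, independent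
Gaussian shadowing and complex normal fading, load with probability mass function `κ`, and a
zero-forcing penalty independent of all of these (its law is left open here). -/
structure IsModel [MeasurableSpace Ω] (net : Network P Ω) (μ : Measure Ω) : Prop where
  measurable_shadow : ∀ j i, Measurable (net.shadow j i)
  measurable_fading : ∀ j i k, Measurable (net.fading j i k)
  measurable_load : Measurable net.load
  measurable_penalty : ∀ j u, Measurable (net.penalty j u)
  poisson : ∀ j, IsPoissonPointProcess (net.num j) (net.loc j) (P.intensityMeasure j) μ
  map_shadow : ∀ j i, μ.map (net.shadow j i) = gaussianReal 0 (P.xi j ^ 2).toNNReal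
  map_fading : ∀ j i k, μ.map (net.fading j i k) = complexNormal
  load_pmf : ∀ n, μ {ω | net.load ω = n} = ENNReal.ofReal (P.kappa n)
  indep : iIndep net.sourceAlgebra μ

/-- Path loss in dB between the typical user and the `i`-th BS of type `j`. -/
def pathLossDB (net : Network P Ω) (j : LinkType) (i : ℕ) (ω : Ω) : ℝ :=
  P.beta + 10 * P.alpha j * Real.logb 10 ‖net.loc j i ω‖ + net.shadow j i ω

/-- Path loss in linear scale between the typical user and the `i`-th BS of type `j`. -/
def pathLoss (net : Network P Ω) (j : LinkType) (i : ℕ) (ω : Ω) : ℝ :=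
  (10 : ℝ) ^ (net.pathLossDB j i ω / 10)

/-- `b = (j, i)` is an existing BS offering the minimum path loss to the typical user. -/
def IsTagged (net : Network P Ω) (ω : Ω) (b : LinkType × ℕ) : Prop :=
  (b.2 : ℕ∞) < net.num b.1 ω ∧
    ∀ (j : LinkType) (i : ℕ), (i : ℕ∞) < net.num j ω →
      net.pathLoss b.1 b.2 ω ≤ net.pathLoss j i ω

/-- The tagged BS, with which the typical user associates. -/
def tagged (net : Network P Ω) (ω : Ω) : LinkType × ℕ :=
  Classical.epsilon (net.IsTagged ω)

/-- The number of multiuser streams of the tagged BS. -/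
def streams (net : Network P Ω) (ω : Ω) : ℕ := min P.UM (net.load ω)

/-- `max_k |γ_k|²` over the paths of a link. -/
def maxGain (net : Network P Ω) (j : LinkType) (i : ℕ) (ω : Ω) : ℝ :=
  ⨆ k : Fin (P.eta j), ‖net.fading j i k ω‖ ^ 2

/-- The SNR of the typical user, served by the tagged BS. -/
def snr (net : Network P Ω) (ω : Ω) : ℝ :=
  let b := net.tagged ω
  P.G / (P.eta b.1 * net.streams ω * P.noise) * net.maxGain b.1 b.2 ω *
    (net.pathLoss b.1 b.2 ω)⁻¹ * net.penalty b.1 (net.streams ω) ω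

variable [MeasurableSpace Ω]

/-- SNR coverage `P(SNR > τ)` of the typical user. -/
def coverage (net : Network P Ω) (μ : Measure Ω) (τ : ℝ) : ℝ :=
  μ.real {ω | τ < net.snr ω}

/-- `S(τ, U) = P(SNR > τ | U streams)`. -/
def condCoverage (net : Network P Ω) (μ : Measure Ω) (τ : ℝ) (U : ℕ) : ℝ :=
  (ProbabilityTheory.cond μ {ω | net.streams ω = U}).real {ω | τ < net.snr ω}

/-- For `U` streams the penalty (on either type of link) stochastically dominates the Bernoulli
variable `p_MU` with success probability `ζ(η_j, U)`. -/
def PenaltyDominates (net : Network P Ω) (μ : Measure Ω) (U : ℕ) : Prop :=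
  ∀ j, StochDominates (μ.map (net.penalty j U)) (bernoulliLaw (P.zeta (P.eta j) U))

/-- For `U` streams the penalty (on either type of link) is the Bernoulli variable `p_MU` with
success probability `ζ(η_j, U)`. -/
def PenaltyIsBernoulli (net : Network P Ω) (μ : Measure Ω) (U : ℕ) : Prop :=
  ∀ j, μ.map (net.penalty j U) = bernoulliLaw (P.zeta (P.eta j) U)

end Network

end MmWave

end

noncomputable section

namespace MmWave

open scoped ENNReal NNReal Topology
open Filter

/-! ### Functionals of Poisson point processes -/

/-! Fix a type j. Attaching independent shadowing to the points of a Poisson process should turn the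
path losses into a Poisson process on (0, ∞) with mean measure λ_BS M_j, so that no loss lies below
t with probability exp(-λ_BS M_j(t)). Only this void probability is needed
(`measure_forall_le_pathLoss`). The indicator of the void event is a product over the points. The
shadowings are integrated out of its finite partial products one at a time
(`lintegral_marked_prod`), which leaves the product of 1 - g(x), where g(x) is the probability that
a link from x has loss below t. The generating functional of the Poisson process
(`lintegral_pointProd`) gives this product the mean exp(-∫ g dΛ). That functional follows from the
independence of counts for step functions and then by monotone limits. By Tonelli, ∫ g dΛ is a
Gaussian average of means over discs, and completing the square yields M_j
(`lintegral_shadowLaw_lossAt`). Campbell's formula makes the number of losses below t almost surely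
finite, so minima are attained. Shadowing has no atoms, so there are no ties. Since M_NLOS is
unbounded, some NLOS station exists. Hence the serving station is almost surely unique
(`ae_isRegular`). Differentiating the void probability gives the density of the smallest loss of
type j (`map_minLoss`). The two types are independent, so service by type j at loss l has the extra
weight exp(-λ_BS M_j̄(l)) (`tsum_lintegral_isTagged`). The squared fading gains are independent
standard exponentials, so their maximum over η paths exceeds c with probability 1 - (1 - e^{-c})^η.
The binomial expansion of this is the alternating sum of the formula. The load is independent of
everything else, so conditioning on the number of streams only fixes U (`cond_streams`). The penalty
is independent too. As τ ≥ 0, a Bernoulli penalty contributes exactly the factor ζ, and a dominating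
penalty at least that much, through the event that the penalty is at least 1. -/

lemma lintegral_poissonMeasure (r : ℝ≥0) (φ : ℕ → ℝ≥0∞) :
    ∫⁻ n, φ n ∂poissonMeasure r =
      ∑' n : ℕ, φ n * ENNReal.ofReal (Real.exp (-r) * r ^ n / n.factorial) := by
  rw [lintegral_countable']
  simp_rw [poissonMeasure_singleton]

lemma lintegral_pow_poissonMeasure (r c : ℝ≥0) :
    ∫⁻ n : ℕ, (c : ℝ≥0∞) ^ n ∂poissonMeasure r =
      ENNReal.ofReal (Real.exp (-((1 - c) * r))) := by
  have key : HasSum (fun n : ℕ => Real.exp (-r) * ((c * r : ℝ) ^ n / n.factorial))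
      (Real.exp (-((1 - c) * r))) := by
    have := (NormedSpace.expSeries_div_hasSum_exp (c * r : ℝ)).mul_left (Real.exp (-r))
    rw [← Real.exp_eq_exp_ℝ, ← Real.exp_add] at this
    rwa [show -((1 - c : ℝ) * r) = -r + c * r by ring]
  rw [lintegral_poissonMeasure, ← key.tsum_eq, ENNReal.ofReal_tsum_of_nonneg (fun n => by positivity)
    key.summable]
  refine tsum_congr fun n => ?_
  rw [← ENNReal.ofReal_coe_nnreal, ← ENNReal.ofReal_pow c.coe_nonneg,
    ← ENNReal.ofReal_mul (by positivity)]
  congr 1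
  rw [mul_pow]
  ring

lemma lintegral_id_poissonMeasure (r : ℝ≥0) :
    ∫⁻ n : ℕ, (n : ℝ≥0∞) ∂poissonMeasure r = r := by
  rw [lintegral_poissonMeasure, tsum_eq_zero_add' ENNReal.summable]
  have h : ∀ n : ℕ, ((n + 1 : ℕ) : ℝ≥0∞) *
      ENNReal.ofReal (Real.exp (-r) * r ^ (n + 1) / (n + 1).factorial) =
      r * ENNReal.ofReal (Real.exp (-r) * r ^ n / n.factorial) := by
    intro n
    rw [← ENNReal.ofReal_natCast, ← ENNReal.ofReal_coe_nnreal, ← ENNReal.ofReal_mul (by positivity),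
      ← ENNReal.ofReal_mul (by positivity), Nat.factorial_succ]
    congr 1
    push_cast
    field_simp
    ring
  simp_rw [h]
  rw [ENNReal.tsum_mul_left, ← ENNReal.ofReal_tsum_of_nonneg (fun n => by positivity)
    (hasSum_one_poissonMeasure r).summable, (hasSum_one_poissonMeasure r).tsum_eq]
  simp

section PointProcess

variable {Ω E : Type*} [MeasurableSpace Ω] [MeasurableSpace E]
  {K : Ω → ℕ∞} {X : ℕ → Ω → E} {Λ : Measure E} {μ : Measure Ω}

omit [MeasurableSpace Ω] [MeasurableSpace E] in
-- Counts as sums of indicators: this form gives their measurability and, after integration, their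
-- mean.
lemma toENNReal_pointCount (A : Set E) (ω : Ω) :
    (pointCount K X A ω : ℝ≥0∞) =
      ∑' i : ℕ, {ω | (i : ℕ∞) < K ω ∧ X i ω ∈ A}.indicator (fun _ => (1 : ℝ≥0∞)) ω := by
  rw [pointCount, ← ENNReal.tsum_set_one]
  exact tsum_subtype {i : ℕ | (i : ℕ∞) < K ω ∧ X i ω ∈ A} fun _ => (1 : ℝ≥0∞)

lemma IsPoissonPointProcess.measurableSet_num (h : IsPoissonPointProcess K X Λ μ) (i : ℕ) :
    MeasurableSet {ω | (i : ℕ∞) < K ω} :=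
  h.measurable_num (MeasurableSet.of_discrete (s := Ioi (i : ℕ∞)))

lemma IsPoissonPointProcess.measurableSet_point (h : IsPoissonPointProcess K X Λ μ) {A : Set E}
    (hA : MeasurableSet A) (i : ℕ) : MeasurableSet {ω | (i : ℕ∞) < K ω ∧ X i ω ∈ A} :=
  (h.measurableSet_num i).inter (h.measurable_loc i hA)

lemma IsPoissonPointProcess.measurable_pointCount (h : IsPoissonPointProcess K X Λ μ) {A : Set E}
    (hA : MeasurableSet A) : Measurable (pointCount K X A) := by
  have h1 : Measurable fun ω => (pointCount K X A ω : ℝ≥0∞) := by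
    simp_rw [toENNReal_pointCount]
    exact Measurable.tsum fun i =>
      measurable_const.indicator (h.measurableSet_point hA i)
  refine measurable_to_countable' fun n => ?_
  convert h1 (measurableSet_singleton (n : ℝ≥0∞)) using 1
  ext ω
  simp

lemma IsPoissonPointProcess.lintegral_pointCount (h : IsPoissonPointProcess K X Λ μ) {A : Set E}
    (hA : MeasurableSet A) (hfin : Λ A ≠ ⊤) (φ : ℕ∞ → ℝ≥0∞) :
    ∫⁻ ω, φ (pointCount K X A ω) ∂μ = ∫⁻ n : ℕ, φ n ∂poissonMeasure (Λ A).toNNReal := by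
  rw [← lintegral_map (f := φ) .of_discrete (h.measurable_pointCount hA), h.map_count A hA hfin,
    lintegral_map .of_discrete .of_discrete]

/-- Campbell's formula. -/
lemma IsPoissonPointProcess.tsum_lintegral [SigmaFinite Λ] (h : IsPoissonPointProcess K X Λ μ)
    {g : E → ℝ≥0∞} (hg : Measurable g) :
    ∑' i : ℕ, ∫⁻ ω in {ω | (i : ℕ∞) < K ω}, g (X i ω) ∂μ = ∫⁻ x, g x ∂Λ := by
  have hK : ∀ i : ℕ, MeasurableSet {ω | (i : ℕ∞) < K ω} := fun i =>
    h.measurableSet_num i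
  -- `ν` is the mean measure of the process. It agrees with `Λ` on sets of finite measure because
  -- the counts there have Poisson means, and σ-finiteness of `Λ` extends this to all sets.
  set ν : Measure E := Measure.sum fun i : ℕ => (μ.restrict {ω | (i : ℕ∞) < K ω}).map (X i) with hν
  have hfin : ∀ A, MeasurableSet A → Λ A ≠ ⊤ → ν A = Λ A := by
    intro A hA hA'
    have h1 := h.lintegral_pointCount hA hA' (fun n => (n : ℝ≥0∞))
    simp only [toENNReal_pointCount, ENat.toENNReal_coe] at h1
    rw [lintegral_id_poissonMeasure, ENNReal.coe_toNNReal hA', lintegral_tsum fun i =>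
      (measurable_const.indicator (h.measurableSet_point hA i)).aemeasurable] at h1
    rw [← h1, hν, Measure.sum_apply _ hA]
    refine tsum_congr fun i => ?_
    rw [lintegral_indicator_const (h.measurableSet_point hA i), one_mul,
      Measure.map_apply (h.measurable_loc i) hA, Measure.restrict_apply (h.measurable_loc i hA),
      inter_comm]
    rfl
  have hνΛ : ν = Λ := by
    rw [Measure.ext_iff_of_iUnion_eq_univ (iUnion_spanningSets Λ)]
    intro n
    ext A hA
    rw [Measure.restrict_apply hA, Measure.restrict_apply hA]
    refine hfin _ (hA.inter (measurableSet_spanningSets Λ n)) (ne_top_of_le_ne_top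
      (measure_spanningSets_lt_top Λ n).ne (measure_mono inter_subset_right))
  rw [← hνΛ, hν, lintegral_sum_measure]
  exact tsum_congr fun i => (lintegral_map hg (h.measurable_loc i)).symm

/-- The product of the values of `v` at the points of the process. -/
def pointProd (K : Ω → ℕ∞) (X : ℕ → Ω → E) (v : E → ℝ≥0∞) (ω : Ω) : ℝ≥0∞ :=
  ⨅ n : ℕ, ∏ i ∈ Finset.range n, if (i : ℕ∞) < K ω then v (X i ω) else 1

omit [MeasurableSpace Ω] [MeasurableSpace E] in
-- For `v ≤ 1` each further point lowers the partial product, so the infimum defining `pointProd` is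
-- a limit, whatever the number of points.
lemma antitone_prod_points (K : Ω → ℕ∞) (X : ℕ → Ω → E) {v : E → ℝ≥0∞} (hv : ∀ x, v x ≤ 1) (ω : Ω) :
    Antitone fun n : ℕ => ∏ i ∈ Finset.range n, if (i : ℕ∞) < K ω then v (X i ω) else 1 := by
  refine antitone_nat_of_succ_le fun n => ?_
  rw [Finset.prod_range_succ]
  refine mul_le_of_le_one_right' ?_
  split_ifs
  exacts [hv _, le_rfl]

lemma IsPoissonPointProcess.measurable_prod_points (h : IsPoissonPointProcess K X Λ μ)
    {v : E → ℝ≥0∞} (hv : Measurable v) (n : ℕ) :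
    Measurable fun ω => ∏ i ∈ Finset.range n, if (i : ℕ∞) < K ω then v (X i ω) else 1 :=
  Finset.measurable_prod _ fun i _ =>
    Measurable.ite (h.measurableSet_num i)
      (hv.comp (h.measurable_loc i)) measurable_const

lemma IsPoissonPointProcess.measurable_pointProd (h : IsPoissonPointProcess K X Λ μ)
    {v : E → ℝ≥0∞} (hv : Measurable v) : Measurable (pointProd K X v) :=
  Measurable.iInf fun n => h.measurable_prod_points hv n

omit [MeasurableSpace Ω] [MeasurableSpace E] in
-- Each `A k` contains finitely many points, so the partial products are eventually constant, with
-- one factor `c k` per point of `A k`.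
lemma pointProd_step {ι : Type*} [Fintype ι] (A : ι → Set E) (c : ι → ℝ≥0∞) (hc : ∀ k, c k ≤ 1)
    [∀ k x, Decidable (x ∈ A k)] {ω : Ω} (hfin : ∀ k, pointCount K X (A k) ω ≠ ⊤) :
    pointProd K X (fun x => ∏ k, if x ∈ A k then c k else 1) ω =
      ∏ k, c k ^ (pointCount K X (A k) ω).toNat := by
  classical
  set S : ι → Set ℕ := fun k => {i : ℕ | (i : ℕ∞) < K ω ∧ X i ω ∈ A k}
  have hS : ∀ k, (S k).Finite := fun k => Set.encard_ne_top_iff.1 (hfin k)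
  have hprod : ∀ n : ℕ, (∏ i ∈ Finset.range n, if (i : ℕ∞) < K ω then
      (∏ k, if X i ω ∈ A k then c k else 1) else 1) =
      ∏ k, c k ^ ((Finset.range n).filter (· ∈ S k)).card := by
    intro n
    have : ∀ i : ℕ, (if (i : ℕ∞) < K ω then (∏ k, if X i ω ∈ A k then c k else 1) else 1) =
        ∏ k, if i ∈ S k then c k else 1 := by
      intro i
      by_cases hi : (i : ℕ∞) < K ω <;> simp [hi, S]
    simp_rw [this]
    rw [Finset.prod_comm]
    refine Finset.prod_congr rfl fun k _ => ?_
    rw [← Finset.prod_filter, Finset.prod_const]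
  obtain ⟨N, hN⟩ : ∃ N : ℕ, ∀ k, ∀ i ∈ S k, i < N := by
    obtain ⟨N, hN⟩ := (Set.finite_iUnion hS).bddAbove
    exact ⟨N + 1, fun k i hi => Nat.lt_succ_of_le (hN (mem_iUnion.2 ⟨k, hi⟩))⟩
  have hcard : ∀ n, N ≤ n → ∀ k, ((Finset.range n).filter (· ∈ S k)).card =
      (pointCount K X (A k) ω).toNat := by
    intro n hn k
    rw [pointCount, ← Set.ncard_def, ← Set.ncard_coe_finset]
    congr 1
    ext i
    simp only [Finset.coe_filter, Finset.mem_range, mem_ofPred_eq]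
    exact ⟨fun hi => hi.2, fun hi => ⟨(hN k i hi).trans_le hn, hi⟩⟩
  have hv : ∀ x, (∏ k, if x ∈ A k then c k else 1) ≤ 1 := fun x =>
    Finset.prod_le_one' fun k _ => by split_ifs; exacts [hc k, le_rfl]
  refine tendsto_nhds_unique (tendsto_atTop_iInf (antitone_prod_points K X hv ω)) ?_
  refine tendsto_const_nhds.congr' ?_
  filter_upwards [eventually_ge_atTop N] with n hn
  rw [hprod]
  exact (Finset.prod_congr rfl fun k _ => by rw [hcard n hn k]).symm

/-- Counts in disjoint sets are independent, so the mean factorizes into Poisson generating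
functions evaluated at the `c k`. -/
lemma IsPoissonPointProcess.lintegral_pointProd_step (h : IsPoissonPointProcess K X Λ μ) {n : ℕ}
    (A : Fin n → Set E) (hA : ∀ k, MeasurableSet (A k))
    (hdisj : Pairwise fun i k => Disjoint (A i) (A k)) (hfin : ∀ k, Λ (A k) ≠ ⊤)
    (c : Fin n → ℝ≥0) (hc : ∀ k, c k ≤ 1) [∀ k x, Decidable (x ∈ A k)] :
    ∫⁻ ω, pointProd K X (fun x => ∏ k, if x ∈ A k then (c k : ℝ≥0∞) else 1) ω ∂μ =
      ENNReal.ofReal (Real.exp (-∑ k, (1 - c k) * (Λ (A k)).toReal)) := by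
  have hae : ∀ᵐ ω ∂μ, ∀ k, pointCount K X (A k) ω ≠ ⊤ := by
    rw [ae_all_iff]
    intro k
    have h1 : ∀ᵐ m ∂(μ.map (pointCount K X (A k))), m ≠ ⊤ := by
      rw [h.map_count _ (hA k) (hfin k), ae_map_iff .of_discrete (MeasurableSet.of_discrete)]
      simp
    exact ae_of_ae_map (h.measurable_pointCount (hA k)).aemeasurable h1
  have h2 : ∫⁻ ω, pointProd K X (fun x => ∏ k, if x ∈ A k then (c k : ℝ≥0∞) else 1) ω ∂μ =
      ∫⁻ ω, ∏ k, (fun m : ℕ∞ => (c k : ℝ≥0∞) ^ m.toNat) (pointCount K X (A k) ω) ∂μ := by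
    refine lintegral_congr_ae ?_
    filter_upwards [hae] with ω hω
    exact pointProd_step A _ (fun k => by exact_mod_cast hc k) hω
  have h3 := (h.indep_count n A hA hdisj).comp (fun k (m : ℕ∞) => (c k : ℝ≥0∞) ^ m.toNat)
    (fun k => .of_discrete)
  rw [h2]
  refine (lintegral_prod_eq_prod_lintegral_of_indepFun _ _ h3 fun k =>
    (Measurable.of_discrete (f := fun m : ℕ∞ => (c k : ℝ≥0∞) ^ m.toNat)).comp
      (h.measurable_pointCount (hA k))).trans ?_
  rw [← Finset.sum_neg_distrib, Real.exp_sum, ENNReal.ofReal_prod_of_nonneg fun _ _ => by positivity]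
  refine Finset.prod_congr rfl fun k _ => ?_
  refine (h.lintegral_pointCount (hA k) (hfin k) fun m => (c k : ℝ≥0∞) ^ m.toNat).trans ?_
  simp only [ENat.toNat_natCast]
  rw [lintegral_pow_poissonMeasure]
  rfl

/-- The step sets are the level sets of the nonzero values of `s`. The zero level set may have
infinite measure, but it contributes only factors 1. -/
lemma IsPoissonPointProcess.lintegral_pointProd_simpleFunc (h : IsPoissonPointProcess K X Λ μ)
    (s : SimpleFunc E ℝ≥0∞) (hs : ∀ x, s x ≤ 1) (hfin : Λ {x | s x ≠ 0} ≠ ⊤) :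
    ∫⁻ ω, pointProd K X (fun x => 1 - s x) ω ∂μ =
      ENNReal.ofReal (Real.exp (-(∫⁻ x, s x ∂Λ).toReal)) := by
  classical
  set R := s.range.filter (· ≠ 0) with hR
  set e := R.equivFin.symm with he
  set A : Fin R.card → Set E := fun k => s ⁻¹' {(e k : ℝ≥0∞)} with hAdef
  have hmem : ∀ k, (e k : ℝ≥0∞) ≤ 1 := by
    intro k
    have := (e k).2
    simp only [hR, Finset.mem_filter, SimpleFunc.mem_range] at this
    obtain ⟨⟨x, hx⟩, -⟩ := this
    rw [← hx]; exact hs x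
  have hne : ∀ k, (e k : ℝ≥0∞) ≠ 0 := fun k => (Finset.mem_filter.1 (e k).2).2
  have hfinA : ∀ k, Λ (A k) ≠ ⊤ := fun k => ne_top_of_le_ne_top hfin (measure_mono fun x hx => by
    simp only [hAdef, mem_preimage, mem_singleton_iff] at hx
    simp only [mem_ofPred_eq, hx]; exact hne k)
  have hdisj : Pairwise fun i k => Disjoint (A i) (A k) := by
    intro i k hik
    refine Set.disjoint_left.2 fun x hx hx' => hik ?_
    simp only [hAdef, mem_preimage, mem_singleton_iff] at hx hx'
    exact e.injective (Subtype.ext (hx.symm.trans hx'))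
  have hv : ∀ x, 1 - s x = ∏ k, if x ∈ A k then (((1 - (e k : ℝ≥0∞)).toNNReal : ℝ≥0) : ℝ≥0∞)
      else 1 := by
    intro x
    by_cases hx : s x = 0
    · rw [Finset.prod_eq_one, hx, tsub_zero]
      intro k _
      rw [if_neg]
      simp only [hAdef, mem_preimage, mem_singleton_iff, hx]
      exact (hne k).symm
    · have hxR : s x ∈ R := Finset.mem_filter.2 ⟨SimpleFunc.mem_range_self s x, hx⟩
      rw [Finset.prod_eq_single (e.symm ⟨s x, hxR⟩)]
      · rw [if_pos (by simp [hAdef]), ENNReal.coe_toNNReal (by simp), Equiv.apply_symm_apply]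
      · intro k _ hk
        rw [if_neg]
        simp only [hAdef, mem_preimage, mem_singleton_iff]
        intro hxk
        exact hk (by rw [Equiv.eq_symm_apply]; exact Subtype.ext hxk.symm)
      · simp
  simp_rw [hv]
  rw [h.lintegral_pointProd_step A (fun k => s.measurableSet_preimage _) hdisj hfinA _
    (fun k => by
      rw [← ENNReal.coe_le_coe, ENNReal.coe_toNNReal (by simp)]
      exact tsub_le_self)]
  congr 3
  rw [SimpleFunc.lintegral_eq_lintegral, SimpleFunc.lintegral,
    ← Finset.sum_filter_add_sum_filter_not s.range (· ≠ 0), ← hR,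
    Finset.sum_eq_zero (s := s.range.filter fun x => ¬x ≠ 0) (by
      intro x hx
      have : x = 0 := by simpa using (Finset.mem_filter.1 hx).2
      simp [this]), add_zero, ← Finset.sum_coe_sort R, ← e.sum_comp, ENNReal.toReal_sum]
  · refine Finset.sum_congr rfl fun k _ => ?_
    rw [ENNReal.toReal_mul]
    congr 1
    rw [ENNReal.coe_toNNReal_eq_toReal, ENNReal.toReal_sub_of_le (hmem k) (by simp)]
    simp
  · intro k _
    exact ENNReal.mul_ne_top (ne_top_of_le_ne_top ENNReal.one_ne_top (hmem k)) (hfinA k)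

omit [MeasurableSpace Ω] [MeasurableSpace E] in
-- The two infima commute, and a finite product of decreasing, finite factors converges to the
-- product of their limits.
lemma pointProd_iInf {v : ℕ → E → ℝ≥0∞} (hv : ∀ m x, v m x ≤ 1) (hanti : Antitone v) (ω : Ω) :
    pointProd K X (fun x => ⨅ m, v m x) ω = ⨅ m, pointProd K X (v m) ω := by
  simp only [pointProd]
  rw [iInf_comm]
  refine iInf_congr fun n => ?_
  have hmono : Antitone fun m => ∏ i ∈ Finset.range n, if (i : ℕ∞) < K ω then v m (X i ω) else 1 := by
    intro a b hab
    refine Finset.prod_le_prod' fun i _ => ?_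
    split_ifs
    exacts [hanti hab _, le_rfl]
  refine tendsto_nhds_unique ?_ (tendsto_atTop_iInf hmono)
  refine ENNReal.tendsto_finsetProd_of_ne_top _ (fun i _ => ?_) fun i _ => ?_
  · split_ifs
    · exact tendsto_atTop_iInf fun a b hab => hanti hab _
    · exact tendsto_const_nhds
  · split_ifs
    · exact ne_top_of_le_ne_top ENNReal.one_ne_top ((iInf_le _ 0).trans (hv 0 _))
    · exact ENNReal.one_ne_top

/-- The generating functional of a Poisson point process. -/
lemma IsPoissonPointProcess.lintegral_pointProd [IsFiniteMeasure μ] [SigmaFinite Λ]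
    (h : IsPoissonPointProcess K X Λ μ) {g : E → ℝ≥0∞} (hg : Measurable g) (hg1 : ∀ x, g x ≤ 1)
    (hfin : ∫⁻ x, g x ∂Λ ≠ ⊤) :
    ∫⁻ ω, pointProd K X (fun x => 1 - g x) ω ∂μ =
      ENNReal.ofReal (Real.exp (-(∫⁻ x, g x ∂Λ).toReal)) := by
  -- Cutting the approximations to the spanning sets gives each one a support of finite `Λ`-measure,
  -- as the simple function case requires.
  set s : ℕ → SimpleFunc E ℝ≥0∞ := fun m =>
    (SimpleFunc.eapprox g m).restrict (spanningSets Λ m) with hs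
  have hsx : ∀ m x, s m x = (spanningSets Λ m).indicator (SimpleFunc.eapprox g m) x := fun m x => by
    rw [hs, SimpleFunc.restrict_apply _ (measurableSet_spanningSets Λ m)]
  have hmono : Monotone fun m x => s m x := by
    intro a b hab x
    simp only [hsx]
    refine (indicator_le_indicator (SimpleFunc.monotone_eapprox g hab x)).trans ?_
    exact indicator_le_indicator_of_subset (monotone_spanningSets Λ hab) (fun _ => zero_le) x
  have hle : ∀ m x, s m x ≤ g x := by
    intro m x
    rw [hsx]
    refine (indicator_le_self' (fun _ _ => zero_le) x).trans ?_
    rw [← SimpleFunc.iSup_eapprox_apply hg x]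
    exact le_iSup (fun m => SimpleFunc.eapprox g m x) m
  have htend : ∀ x, Tendsto (fun m => s m x) atTop (𝓝 (g x)) := by
    intro x
    have h1 : Tendsto (fun m => SimpleFunc.eapprox g m x) atTop (𝓝 (g x)) := by
      rw [← SimpleFunc.iSup_eapprox_apply hg x]
      exact tendsto_atTop_iSup fun a b hab => SimpleFunc.monotone_eapprox g hab x
    refine h1.congr' ?_
    obtain ⟨N, hN⟩ : ∃ N, x ∈ spanningSets Λ N := by
      exact mem_iUnion.1 ((iUnion_spanningSets Λ).ge (mem_univ x))
    filter_upwards [eventually_ge_atTop N] with m hm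
    rw [hsx, indicator_of_mem (monotone_spanningSets Λ hm hN)]
  have hvanti : Antitone fun (m : ℕ) (x : E) => 1 - s m x := fun a b hab x =>
    tsub_le_tsub_left (hmono hab x) 1
  have hv : (fun x => 1 - g x) = fun x => ⨅ m, (1 - s m x) := by
    funext x
    refine tendsto_nhds_unique ?_ (tendsto_atTop_iInf fun a b hab => hvanti hab x)
    exact ENNReal.Tendsto.sub tendsto_const_nhds (htend x) (Or.inl ENNReal.one_ne_top)
  have hfin' : ∀ m, Λ {x | s m x ≠ 0} ≠ ⊤ := fun m =>
    ne_top_of_le_ne_top (measure_spanningSets_lt_top Λ m).ne (measure_mono fun x hx => by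
      by_contra hx'
      exact hx (by rw [hsx, indicator_of_notMem hx']))
  have hvm : ∀ m, Measurable fun x => 1 - s m x := fun m => measurable_const.sub (s m).measurable
  have hanti2 : Antitone fun m => pointProd K X fun x => 1 - s m x := fun a b hab ω => by
    refine iInf_mono fun n => Finset.prod_le_prod' fun i _ => ?_
    split_ifs
    exacts [hvanti hab _, le_rfl]
  rw [hv]
  simp_rw [pointProd_iInf (fun m x => tsub_le_self) hvanti]
  -- Monotone convergence for a decreasing sequence, whose first term must have a finite integral;
  -- that is the last goal below.
  rw [lintegral_iInf (fun m => h.measurable_pointProd (hvm m)) hanti2]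
  · simp_rw [fun m => h.lintegral_pointProd_simpleFunc (s m) (fun x => (hle m x).trans (hg1 x))
      (hfin' m)]
    have hint : Tendsto (fun m => ∫⁻ x, s m x ∂Λ) atTop (𝓝 (∫⁻ x, g x ∂Λ)) :=
      lintegral_tendsto_of_tendsto_of_monotone (fun m => (s m).measurable.aemeasurable)
        (ae_of_all _ fun x a b hab => hmono hab x) (ae_of_all _ htend)
    refine tendsto_nhds_unique (tendsto_atTop_iInf fun a b hab => ?_) ?_
    · refine ENNReal.ofReal_le_ofReal (Real.exp_le_exp.2 (neg_le_neg ?_))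
      exact ENNReal.toReal_mono (ne_top_of_le_ne_top hfin (lintegral_mono (hle b)))
        (lintegral_mono (hmono hab))
    · refine ENNReal.tendsto_ofReal (Real.continuous_exp.continuousAt.tendsto.comp ?_)
      exact ((ENNReal.tendsto_toReal hfin).comp hint).neg
  · rw [h.lintegral_pointProd_simpleFunc (s 0) (fun x => (hle 0 x).trans (hg1 x)) (hfin' 0)]
    exact ENNReal.ofReal_ne_top

end PointProcess

/-! ### The Gaussian tail -/

lemma gaussQ_eq_integral (x : ℝ) : gaussQ x = ∫ y in Ioi x, gaussianPDFReal 0 1 y := by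
  rw [gaussQ, measureReal_def, gaussianReal_apply_eq_integral _ one_ne_zero,
    ENNReal.toReal_ofReal (integral_nonneg fun _ => gaussianPDFReal_nonneg _ _ _)]

lemma gaussQ_nonneg (x : ℝ) : 0 ≤ gaussQ x := measureReal_nonneg

lemma gaussQ_le_one (x : ℝ) : gaussQ x ≤ 1 := measureReal_le_one

lemma gaussianReal_real_Iic_neg (x : ℝ) : (gaussianReal 0 1).real (Iic (-x)) = gaussQ x := by
  have : NullSingletonClass (gaussianReal 0 1) := nullSingletonClass_gaussianReal one_ne_zero
  have h : (gaussianReal 0 1).map (fun x => -x) = gaussianReal 0 1 := by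
    rw [gaussianReal_map_neg, neg_zero]
  rw [gaussQ, measureReal_congr Ioi_ae_eq_Ici]
  nth_rw 2 [← h]
  rw [map_measureReal_apply measurable_neg measurableSet_Ici]
  congr 1
  ext y
  simp

lemma continuous_gaussianPDFReal (m : ℝ) (v : ℝ≥0) : Continuous (gaussianPDFReal m v) := by
  rw [gaussianPDFReal_def]
  fun_prop

lemma hasDerivAt_gaussQ (x : ℝ) : HasDerivAt gaussQ (-gaussianPDFReal 0 1 x) x := by
  have h : ∀ y, gaussQ y = gaussQ 0 - ∫ z in (0 : ℝ)..y, gaussianPDFReal 0 1 z := by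
    intro y
    rw [gaussQ_eq_integral, gaussQ_eq_integral,
      ← intervalIntegral.integral_Ioi_sub_Ioi' (integrable_gaussianPDFReal _ _).integrableOn
        (integrable_gaussianPDFReal _ _).integrableOn]
    ring
  rw [funext h]
  have hc := continuous_gaussianPDFReal 0 1
  exact (intervalIntegral.integral_hasDerivAt_right (hc.intervalIntegrable _ _)
    (hc.stronglyMeasurableAtFilter _ _) hc.continuousAt).const_sub _

lemma continuous_gaussQ : Continuous gaussQ :=
  continuous_iff_continuousAt.2 fun x => (hasDerivAt_gaussQ x).continuousAt

lemma tendsto_gaussQ_atTop : Tendsto gaussQ atTop (𝓝 0) := by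
  have h : Tendsto (fun x : ℝ => gaussianReal 0 1 (Ioi x)) atTop (𝓝 (gaussianReal 0 1 (⋂ x : ℝ, Ioi x))) :=
    tendsto_measure_iInter_atTop (fun _ => measurableSet_Ioi.nullMeasurableSet)
      (fun a b hab => Ioi_subset_Ioi hab) ⟨0, measure_ne_top _ _⟩
  have he : (⋂ x : ℝ, Ioi x) = ∅ := by
    ext y
    simpa using ⟨y, le_rfl⟩
  rw [he, measure_empty] at h
  exact (ENNReal.tendsto_toReal ENNReal.zero_ne_top).comp h

/-- Completing the square: with φ the standard Gaussian density, e^{-az} φ(z) = e^{a²/2} φ(z + a). A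
translation by `a` then moves the half-line. -/
lemma setIntegral_exp_gaussianReal (a c : ℝ) :
    ∫ z in Ioi c, Real.exp (-(a * z)) ∂gaussianReal 0 1 = Real.exp (a ^ 2 / 2) * gaussQ (c + a) := by
  rw [← integral_indicator measurableSet_Ioi, integral_gaussianReal_eq_integral_smul one_ne_zero,
    gaussQ_eq_integral, ← integral_const_mul, ← integral_indicator measurableSet_Ioi]
  refine Eq.trans ?_ (integral_add_right_eq_self _ a)
  congr 1
  funext z
  by_cases hz : c < z
  · rw [indicator_of_mem (mem_Ioi.2 hz), indicator_of_mem (mem_Ioi.2 (by linarith)),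
      gaussianPDFReal_def]
    simp only [smul_eq_mul]
    rw [mul_assoc, ← Real.exp_add, mul_left_comm, ← Real.exp_add]
    congr 2
    simp
    ring
  · rw [indicator_of_notMem (by simpa using hz), smul_zero, indicator_of_notMem (by simpa using hz)]

/-! ### Mean number of base stations with small path loss -/

namespace Params

variable (P : Params) (j : LinkType)

/-- The distance below which the path loss is smaller than `t`, for standardized shadowing `z`. -/
def radius (t z : ℝ) : ℝ :=
  Real.exp ((Real.log t + P.m - P.sigma j * z) / P.alpha j)

lemma sigma_pos : 0 < P.sigma j := by
  have := P.xi_pos j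
  have := Real.log_pos (show (1 : ℝ) < 10 by norm_num)
  unfold sigma
  positivity

lemma radius_pos (t z : ℝ) : 0 < P.radius j t z := Real.exp_pos _

lemma continuous_radius (t : ℝ) : Continuous (P.radius j t) := by
  unfold radius
  fun_prop

/-- The radius decreases in the shadowing, and -Υ is where it crosses `D`. The truncation at `D` is
thus active exactly below -Υ. -/
lemma radius_le_D_iff {t : ℝ} (ht : 0 < t) (z : ℝ) :
    P.radius j t z ≤ P.D ↔ -P.upsilon j t ≤ z := by
  have hα := P.alpha_pos j
  have hσ := P.sigma_pos j
  have hD := P.D_pos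
  rw [radius, ← Real.le_log_iff_exp_le hD, div_le_iff₀ hα, upsilon, neg_le, le_div_iff₀ hσ,
    Real.log_div (Real.rpow_pos_of_pos hD _).ne' ht.ne', Real.log_rpow hD]
  constructor <;> intro h <;> linarith

lemma radius_sq {t : ℝ} (ht : 0 < t) (z : ℝ) :
    P.radius j t z ^ 2 = t ^ (2 / P.alpha j) * Real.exp (2 * P.m / P.alpha j) *
      Real.exp (-(2 * P.sigma j / P.alpha j * z)) := by
  rw [radius, ← Real.exp_nat_mul, Real.rpow_def_of_pos ht, ← Real.exp_add, ← Real.exp_add]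
  congr 1
  push_cast
  ring

lemma two_sigma_div : 2 * P.sigma j ^ 2 / (P.alpha j * P.sigma j) = 2 * P.sigma j / P.alpha j := by
  have hα := (P.alpha_pos j).ne'
  have hσ := (P.sigma_pos j).ne'
  field_simp

lemma expFactor_eq : P.expFactor j =
    Real.exp (2 * P.m / P.alpha j) * Real.exp ((2 * P.sigma j / P.alpha j) ^ 2 / 2) := by
  rw [expFactor, ← Real.exp_add]
  congr 1
  ring

lemma integrable_exp_gaussianReal (a : ℝ) :
    Integrable (fun z => Real.exp (-(a * z))) (gaussianReal 0 1) := by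
  simpa using integrable_exp_mul_gaussianReal (μ := 0) (v := 1) (-a)

lemma integrable_radius_sq {t : ℝ} (ht : 0 < t) :
    Integrable (fun z => P.radius j t z ^ 2) (gaussianReal 0 1) := by
  simp_rw [P.radius_sq j ht]
  exact (integrable_exp_gaussianReal _).const_mul _

lemma integral_radius_sq {t : ℝ} (ht : 0 < t) :
    ∫ z, P.radius j t z ^ 2 ∂gaussianReal 0 1 = t ^ (2 / P.alpha j) * P.expFactor j := by
  simp_rw [P.radius_sq j ht]
  rw [integral_const_mul, expFactor_eq]
  have h := congrFun (mgf_fun_id_gaussianReal (μ := 0) (v := 1)) (-(2 * P.sigma j / P.alpha j))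
  simp only [mgf, neg_mul] at h
  rw [h]
  simp [mul_assoc]

lemma integrable_min_radius_sq (t : ℝ) :
    Integrable (fun z => min (P.radius j t z) P.D ^ 2) (gaussianReal 0 1) := by
  refine Integrable.of_bound ((P.continuous_radius j t).min continuous_const |>.pow 2
    |>.aestronglyMeasurable) (P.D ^ 2) (ae_of_all _ fun z => ?_)
  have h0 : 0 ≤ min (P.radius j t z) P.D := le_min (P.radius_pos j t z).le P.D_pos.le
  rw [Real.norm_of_nonneg (by positivity)]
  exact pow_le_pow_left₀ h0 (min_le_right _ _) 2

/-- Split at z = -Υ. Below, the minimum is the constant `D`, and symmetry of the Gaussian gives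
Q(Υ). Above, the squared radius is exponential in z, and `setIntegral_exp_gaussianReal` gives the
shifted tail. -/
lemma integral_min_radius_sq {t : ℝ} (ht : 0 < t) :
    ∫ z, min (P.radius j t z) P.D ^ 2 ∂gaussianReal 0 1 =
      P.D ^ 2 * gaussQ (P.upsilon j t) + t ^ (2 / P.alpha j) * P.expFactor j *
        gaussQ (2 * P.sigma j ^ 2 / (P.alpha j * P.sigma j) - P.upsilon j t) := by
  rw [← integral_add_compl (s := Iic (-P.upsilon j t)) measurableSet_Iic
    (P.integrable_min_radius_sq j t), compl_Iic]
  congr 1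
  · rw [setIntegral_congr_fun (g := fun _ => P.D ^ 2) measurableSet_Iic, setIntegral_const,
      gaussianReal_real_Iic_neg, smul_eq_mul, mul_comm]
    intro z hz
    rcases eq_or_lt_of_le (mem_Iic.1 hz) with h | h
    · have h1 := (P.radius_le_D_iff j ht z).2 h.ge
      -- At the crossing point the equivalence gives only one inequality; the other follows by
      -- continuity from the left.
      have h2 : P.D ≤ P.radius j t z := by
        by_contra! hlt
        have hc : Tendsto (P.radius j t) (𝓝[<] z) (𝓝 (P.radius j t z)) :=
          ((P.continuous_radius j t).tendsto z).mono_left nhdsWithin_le_nhds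
        obtain ⟨y, hy, hyz⟩ := ((hc.eventually_lt_const hlt).and self_mem_nhdsWithin).exists
        have := (P.radius_le_D_iff j ht y).1 hy.le
        exact absurd (h ▸ hyz : y < -P.upsilon j t) this.not_gt
      simp [min_eq_right h2]
    · have h2 : P.D < P.radius j t z := by
        rw [← not_le, P.radius_le_D_iff j ht z, not_le]
        exact h
      simp [min_eq_right h2.le]
  · rw [setIntegral_congr_fun (g := fun z => t ^ (2 / P.alpha j) * Real.exp (2 * P.m / P.alpha j) *
      Real.exp (-(2 * P.sigma j / P.alpha j * z))) measurableSet_Ioi, integral_const_mul,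
      setIntegral_exp_gaussianReal, P.two_sigma_div, P.expFactor_eq]
    · rw [show -P.upsilon j t + 2 * P.sigma j / P.alpha j = 2 * P.sigma j / P.alpha j - P.upsilon j t
        by ring]
      ring
    · intro z hz
      have h1 := (P.radius_le_D_iff j ht z).2 (mem_Ioi.1 hz).le
      simp only [min_eq_left h1, P.radius_sq j ht]

/-- The mean number of BSs of type `j` at distance less than `r`. -/
def ballMean (j : LinkType) (r : ℝ) : ℝ :=
  match j with
  | .LOS => P.lamBS * P.pLOS * (Real.pi * min r P.D ^ 2)
  | .NLOS => P.lamBS * (Real.pi * (r ^ 2 - P.pLOS * min r P.D ^ 2))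

lemma ballMean_nonneg {r : ℝ} (hr : 0 ≤ r) : 0 ≤ P.ballMean j r := by
  have h1 := P.lamBS_pos
  have h2 := P.pLOS_pos
  have h3 := P.pLOS_le_one
  have h4 : 0 ≤ min r P.D := le_min hr P.D_pos.le
  have h5 : min r P.D ^ 2 ≤ r ^ 2 := pow_le_pow_left₀ h4 (min_le_left _ _) 2
  cases j
  · simp only [ballMean]
    positivity
  · simp only [ballMean]
    have : 0 ≤ r ^ 2 - P.pLOS * min r P.D ^ 2 := by nlinarith [sq_nonneg (min r P.D)]
    positivity

lemma volume_ball_inter {r : ℝ} (hr : 0 ≤ r) :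
    volume (Metric.ball (0 : Plane) r ∩ Metric.closedBall 0 P.D) =
      ENNReal.ofReal (Real.pi * min r P.D ^ 2) := by
  have hD := P.D_pos.le
  rcases le_or_gt r P.D with h | h
  · rw [inter_eq_left.2 (Metric.ball_subset_closedBall.trans (Metric.closedBall_subset_closedBall h)),
      EuclideanSpace.volume_ball_fin_two, min_eq_left h, ← ENNReal.ofReal_pow hr, ← ENNReal.ofReal_mul (by positivity),
      mul_comm]
  · rw [inter_eq_right.2 (Metric.closedBall_subset_ball h),
      EuclideanSpace.volume_closedBall_fin_two, min_eq_right h.le, ← ENNReal.ofReal_pow hD, ← ENNReal.ofReal_mul (by positivity),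
      mul_comm]

lemma intensityMeasure_ball {r : ℝ} (hr : 0 ≤ r) :
    P.intensityMeasure j (Metric.ball 0 r) = ENNReal.ofReal (P.ballMean j r) := by
  have h1 := P.lamBS_pos.le
  have h2 := P.pLOS_pos.le
  have h3 := sub_nonneg.2 P.pLOS_le_one
  have hvol : volume (Metric.ball (0 : Plane) r) = ENNReal.ofReal (Real.pi * r ^ 2) := by
    rw [EuclideanSpace.volume_ball_fin_two, ← ENNReal.ofReal_pow hr, ← ENNReal.ofReal_mul (by positivity),
      mul_comm]
  rw [intensityMeasure, withDensity_apply _ measurableSet_ball]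
  cases j
  · have : (fun x : Plane => ENNReal.ofReal (P.intensity .LOS x)) =
        (Metric.closedBall 0 P.D).indicator fun _ => ENNReal.ofReal (P.lamBS * P.pLOS) := by
      funext x
      by_cases hx : ‖x‖ ≤ P.D <;> simp [intensity, indicator, hx]
    rw [this, lintegral_indicator measurableSet_closedBall, Measure.restrict_restrict
      measurableSet_closedBall, setLIntegral_const, inter_comm, P.volume_ball_inter hr,
      ← ENNReal.ofReal_mul (by positivity)]
    rfl
  -- The NLOS intensity is split into the constant λ_BS (1 - p_LOS) on the whole plane plus λ_BS
  -- p_LOS outside the disc of radius `D`.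
  · have : (fun x : Plane => ENNReal.ofReal (P.intensity .NLOS x)) = fun x =>
        ENNReal.ofReal (P.lamBS * (1 - P.pLOS)) +
        (Metric.closedBall 0 P.D)ᶜ.indicator (fun _ => ENNReal.ofReal (P.lamBS * P.pLOS)) x := by
      funext x
      by_cases hx : ‖x‖ ≤ P.D
      · simp [intensity, indicator, hx]
      · simp only [intensity, hx, if_false, indicator, mem_compl_iff, Metric.mem_closedBall,
          dist_zero_right, not_false_eq_true, if_true]
        rw [← ENNReal.ofReal_add (by positivity) (by positivity)]
        congr 1
        ring
    have h5 : min r P.D ^ 2 ≤ r ^ 2 :=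
      pow_le_pow_left₀ (le_min hr P.D_pos.le) (min_le_left _ _) 2
    have hdiff : volume (Metric.ball (0 : Plane) r ∩ (Metric.closedBall 0 P.D)ᶜ) =
        ENNReal.ofReal (Real.pi * r ^ 2 - Real.pi * min r P.D ^ 2) := by
      rw [← Set.sdiff_eq, ← sdiff_inter_self_eq_sdiff, inter_comm, measure_sdiff inter_subset_left
        (measurableSet_ball.inter measurableSet_closedBall).nullMeasurableSet, hvol,
        P.volume_ball_inter hr, ENNReal.ofReal_sub _ (by positivity)]
      rw [P.volume_ball_inter hr]
      exact ENNReal.ofReal_ne_top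
    rw [this, lintegral_add_left measurable_const, setLIntegral_const, hvol,
      lintegral_indicator measurableSet_closedBall.compl, Measure.restrict_restrict
      measurableSet_closedBall.compl, setLIntegral_const, inter_comm, hdiff,
      ← ENNReal.ofReal_mul (by positivity), ← ENNReal.ofReal_mul (by positivity),
      ← ENNReal.ofReal_add (by positivity) (mul_nonneg (by positivity) (by
        rw [← mul_sub]; exact mul_nonneg Real.pi_nonneg (sub_nonneg.2 h5)))]
    congr 1
    simp only [ballMean]
    ring

lemma integrable_ballMean {t : ℝ} (ht : 0 < t) :
    Integrable (fun z => P.ballMean j (P.radius j t z)) (gaussianReal 0 1) := by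
  cases j
  · exact ((P.integrable_min_radius_sq .LOS t).const_mul _).const_mul _
  · exact (((P.integrable_radius_sq .NLOS ht).sub
      ((P.integrable_min_radius_sq .NLOS t).const_mul _)).const_mul _).const_mul _

lemma integral_ballMean {t : ℝ} (ht : 0 < t) :
    ∫ z, P.ballMean j (P.radius j t z) ∂gaussianReal 0 1 = P.lamBS * P.M j t := by
  cases j
  · simp only [ballMean]
    rw [integral_const_mul, integral_const_mul, P.integral_min_radius_sq .LOS ht, M]
    ring
  · simp only [ballMean]
    rw [integral_const_mul, integral_const_mul, integral_sub (P.integrable_radius_sq .NLOS ht)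
      ((P.integrable_min_radius_sq .NLOS t).const_mul _), integral_const_mul,
      P.integral_min_radius_sq .NLOS ht, P.integral_radius_sq .NLOS ht, M]
    ring

lemma lamBS_mul_M_nonneg {t : ℝ} (ht : 0 < t) : 0 ≤ P.lamBS * P.M j t := by
  rw [← P.integral_ballMean j ht]
  exact integral_nonneg fun z => P.ballMean_nonneg j (P.radius_pos j t z).le

lemma ballMean_mono {r r' : ℝ} (hr : 0 ≤ r) (h : r ≤ r') : P.ballMean j r ≤ P.ballMean j r' := by
  rw [← ENNReal.ofReal_le_ofReal_iff (P.ballMean_nonneg j (hr.trans h)),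
    ← P.intensityMeasure_ball j hr, ← P.intensityMeasure_ball j (hr.trans h)]
  exact measure_mono (Metric.ball_subset_ball h)

/-- Read off the integral representation: for every shadowing value a larger `t` means a larger
disc. The closed form has terms of both signs and does not show this. -/
lemma monotoneOn_M : MonotoneOn (P.M j) (Ioi 0) := by
  intro s hs t ht hst
  refine le_of_mul_le_mul_left ?_ P.lamBS_pos
  rw [← P.integral_ballMean j hs, ← P.integral_ballMean j ht]
  refine integral_mono (P.integrable_ballMean j hs) (P.integrable_ballMean j ht) fun z => ?_
  refine P.ballMean_mono j (P.radius_pos j s z).le ?_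
  have hα := P.alpha_pos j
  have := Real.log_le_log hs hst
  unfold radius
  gcongr

lemma hasDerivAt_upsilon {t : ℝ} (ht : 0 < t) :
    HasDerivAt (P.upsilon j) (-1 / (P.sigma j * t)) t := by
  have hD : P.D ^ P.alpha j ≠ 0 := (Real.rpow_pos_of_pos P.D_pos _).ne'
  have hσ := (P.sigma_pos j).ne'
  have h := ((((hasDerivAt_inv ht.ne').const_mul (P.D ^ P.alpha j)).log
    (mul_ne_zero hD (inv_ne_zero ht.ne'))).sub_const P.m).div_const (P.sigma j)
  simp only [← div_eq_mul_inv] at h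
  refine HasDerivAt.congr_deriv h ?_
  have := ht.ne'
  field_simp

lemma hasDerivAt_gaussQ_upsilon {t : ℝ} (ht : 0 < t) :
    HasDerivAt (fun t => gaussQ (P.upsilon j t))
      (1 / (√(2 * Real.pi) * t * P.sigma j) * Real.exp (-P.upsilon j t ^ 2 / 2)) t := by
  refine ((hasDerivAt_gaussQ (P.upsilon j t)).comp t (P.hasDerivAt_upsilon j ht)).congr_deriv ?_
  rw [gaussianPDFReal_def]
  have hσ := (P.sigma_pos j).ne'
  have := ht.ne'
  simp
  field_simp

lemma hasDerivAt_gaussQ_sub_upsilon {t : ℝ} (ht : 0 < t) :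
    HasDerivAt (fun t => gaussQ (2 * P.sigma j ^ 2 / (P.alpha j * P.sigma j) - P.upsilon j t))
      (-(1 / √(2 * Real.pi * P.sigma j ^ 2) *
              Real.exp (-(√2 * P.sigma j / P.alpha j - P.upsilon j t / √2) ^ 2)) / t) t := by
  have hσ := P.sigma_pos j
  have h0 := ht.ne'
  have h2 : √2 ^ 2 = (2 : ℝ) := Real.sq_sqrt (by norm_num)
  refine ((hasDerivAt_gaussQ _).comp t ((P.hasDerivAt_upsilon j ht).const_sub _)).congr_deriv ?_
  rw [gaussianPDFReal_def, P.two_sigma_div, Real.sqrt_mul (by positivity : (0 : ℝ) ≤ 2 * Real.pi) (P.sigma j ^ 2),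
    Real.sqrt_sq hσ.le]
  -- The exponent written in `M'` is -x²/2 with x = 2σ/α - Υ, the argument of Q.
  have he : -(√2 * P.sigma j / P.alpha j - P.upsilon j t / √2) ^ 2 =
      -(2 * P.sigma j / P.alpha j - P.upsilon j t) ^ 2 / 2 := by
    have hs : √2 * P.sigma j / P.alpha j - P.upsilon j t / √2 =
        (2 * P.sigma j / P.alpha j - P.upsilon j t) / √2 := by
      field_simp
      rw [h2]
      ring
    rw [hs, div_pow, h2]
    ring
  rw [he]
  simp
  field_simp

lemma hasDerivAt_M {t : ℝ} (ht : 0 < t) : HasDerivAt (P.M j) (P.M' j t) t := by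
  have hpow : ∀ j, HasDerivAt (fun t : ℝ => t ^ (2 / P.alpha j))
      (2 / P.alpha j * t ^ (2 / P.alpha j - 1)) t := fun j =>
    Real.hasDerivAt_rpow_const (Or.inl ht.ne')
  have hsub : ∀ j, t ^ (2 / P.alpha j) = t ^ (2 / P.alpha j - 1) * t := fun j => by
    rw [Real.rpow_sub_one ht.ne', div_mul_cancel₀ _ ht.ne']
  have hp := P.pLOS_pos.ne'
  have h0 := ht.ne'
  cases j
  · have h : HasDerivAt (P.M .LOS) _ t := ((((P.hasDerivAt_gaussQ_upsilon .LOS ht).const_mul (P.D ^ 2))).add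
      ((((hpow .LOS).mul_const (P.expFactor .LOS)).mul
        (P.hasDerivAt_gaussQ_sub_upsilon .LOS ht)))).const_mul (Real.pi * P.pLOS)
    refine HasDerivAt.congr_deriv h ?_
    simp only [M']
    rw [hsub]
    field_simp
    ring
  · have h : HasDerivAt (P.M .NLOS) _ t := ((P.hasDerivAt_gaussQ_upsilon .NLOS ht).const_mul (-Real.pi * P.pLOS * P.D ^ 2)).add
      ((((hpow .NLOS).const_mul Real.pi).mul_const (P.expFactor .NLOS)).mul
        (((P.hasDerivAt_gaussQ_sub_upsilon .NLOS ht).const_mul P.pLOS).const_sub 1))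
    refine HasDerivAt.congr_deriv h ?_
    simp only [M']
    rw [hsub]
    field_simp
    ring

/-- The sign comes from the monotonicity of `M`, not from the closed form of the derivative. -/
lemma M'_nonneg {t : ℝ} (ht : 0 < t) : 0 ≤ P.M' j t := by
  rw [← ((P.hasDerivAt_M j ht).hasDerivWithinAt.derivWithin
    (isOpen_Ioi.uniqueDiffWithinAt (mem_Ioi.2 ht)))]
  exact (P.monotoneOn_M j).derivWithin_nonneg

/-- As t grows, Υ tends to -∞ and the shifted tail vanishes, so the power t^{2/α} dominates the
bounded LOS correction. -/
lemma tendsto_M_NLOS : Tendsto (P.M .NLOS) atTop atTop := by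
  have hα := P.alpha_pos .NLOS
  have hσ := P.sigma_pos .NLOS
  have hD := P.D_pos
  have hp := P.pLOS_pos
  have hu : Tendsto (P.upsilon .NLOS) atTop atBot := by
    have h1 : Tendsto (fun t => (P.alpha .NLOS * Real.log P.D - P.m - Real.log t) / P.sigma .NLOS)
        atTop atBot := by
      refine Tendsto.atBot_div_const hσ ?_
      exact tendsto_atBot_add_const_left _ _ (tendsto_neg_atTop_atBot.comp Real.tendsto_log_atTop)
    refine h1.congr' ?_
    filter_upwards [eventually_gt_atTop 0] with t ht
    rw [upsilon, Real.log_div (Real.rpow_pos_of_pos hD _).ne' ht.ne', Real.log_rpow hD]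
    ring
  have hQ := tendsto_gaussQ_atTop.comp (tendsto_atTop_add_const_left atTop
    (2 * P.sigma .NLOS ^ 2 / (P.alpha .NLOS * P.sigma .NLOS)) (tendsto_neg_atBot_atTop.comp hu))
  -- A lower bound for `M`: once the shifted tail is below 1/2, the bracket exceeds 1/2 because
  -- p_LOS ≤ 1, and the other tail is at most 1.
  have h1 : Tendsto (fun t => -(Real.pi * P.pLOS * P.D ^ 2) +
      Real.pi * t ^ (2 / P.alpha .NLOS) * P.expFactor .NLOS * (1 / 2)) atTop atTop := by
    refine tendsto_atTop_add_const_left _ _ (Tendsto.atTop_mul_const (by norm_num)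
      (Tendsto.atTop_mul_const (Real.exp_pos _) (Tendsto.const_mul_atTop Real.pi_pos
        (tendsto_rpow_atTop (by positivity)))))
  refine tendsto_atTop_mono' _ ?_ h1
  filter_upwards [eventually_gt_atTop 0, hQ.eventually_lt_const (show (0 : ℝ) < 1 / 2 by norm_num)]
    with t ht hq
  have h2 := gaussQ_le_one (P.upsilon .NLOS t)
  have h3 := gaussQ_nonneg (2 * P.sigma .NLOS ^ 2 / (P.alpha .NLOS * P.sigma .NLOS) -
    P.upsilon .NLOS t)
  simp only [Function.comp_apply, ← sub_eq_add_neg] at hq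
  have h4 := P.pLOS_le_one
  simp only [M]
  refine add_le_add ?_ ?_
  · have : 0 ≤ Real.pi * P.pLOS * P.D ^ 2 := by positivity
    nlinarith
  · have : 0 < P.expFactor .NLOS := Real.exp_pos _
    refine mul_le_mul_of_nonneg_left ?_ (by positivity)
    nlinarith

/-! ### The path loss -/

/-- Path loss (in linear scale) of a link of type `j` from the location `x` with shadowing `s`. -/
def lossAt (x : Plane) (s : ℝ) : ℝ :=
  (10 : ℝ) ^ ((P.beta + 10 * P.alpha j * Real.logb 10 ‖x‖ + s) / 10)

lemma lossAt_pos (x : Plane) (s : ℝ) : 0 < P.lossAt j x s := Real.rpow_pos_of_pos (by norm_num) _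

lemma measurable_lossAt : Measurable fun p : Plane × ℝ => P.lossAt j p.1 p.2 := by
  unfold lossAt Real.logb
  fun_prop

lemma lossAt_inj (x : Plane) {s s' : ℝ} (h : P.lossAt j x s = P.lossAt j x s') : s = s' := by
  unfold lossAt at h
  have := (Real.rpow_right_inj (by norm_num : (0 : ℝ) < 10) (by norm_num)).1 h
  linarith

/-- The origin must be excluded: there `Real.logb` takes its default value 0, so the loss is not
small. The origin is a null set for the intensity. -/
lemma lossAt_lt_iff {x : Plane} (hx : x ≠ 0) {t : ℝ} (ht : 0 < t) (z : ℝ) :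
    P.lossAt j x (P.xi j * z) < t ↔ ‖x‖ < P.radius j t z := by
  have hα := P.alpha_pos j
  have h10 := Real.log_pos (show (1 : ℝ) < 10 by norm_num)
  rw [lossAt, radius, ← Real.log_lt_log_iff (Real.rpow_pos_of_pos (by norm_num) _) ht,
    Real.log_rpow (by norm_num), ← Real.log_lt_iff_lt_exp (norm_pos_iff.2 hx), lt_div_iff₀ hα,
    m, sigma, Real.logb]
  have : (P.beta + 10 * P.alpha j * (Real.log ‖x‖ / Real.log 10) + P.xi j * z) / 10 * Real.log 10 =
      0.1 * P.beta * Real.log 10 + P.alpha j * Real.log ‖x‖ + 0.1 * P.xi j * Real.log 10 * z := by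
    field_simp
    ring
  rw [this]
  constructor <;> intro h <;> linarith

attribute [irreducible] lossAt

instance : SigmaFinite (P.intensityMeasure j) := by
  unfold intensityMeasure
  exact SigmaFinite.withDensity_ofReal _

lemma intensityMeasure_zero : P.intensityMeasure j {0} = 0 :=
  withDensity_absolutelyContinuous _ _ (by simp)

/-- The shadowing law. -/
abbrev shadowLaw : Measure ℝ := gaussianReal 0 (P.xi j ^ 2).toNNReal

lemma shadowLaw_eq : P.shadowLaw j = (gaussianReal 0 1).map (P.xi j * ·) := by
  rw [gaussianReal_map_const_mul, mul_zero, mul_one, shadowLaw, Real.toNNReal_of_nonneg (sq_nonneg _)]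

lemma measurable_shadowLaw_lossAt (t : ℝ) :
    Measurable fun x => P.shadowLaw j {s | P.lossAt j x s < t} :=
  measurable_measure_prodMk_left (measurableSet_lt (P.measurable_lossAt j) measurable_const)

/-- Tonelli exchanges location and shadowing. For fixed shadowing the locations with loss below `t`
form, up to the origin, a disc, whose mean is known. -/
lemma lintegral_shadowLaw_lossAt {t : ℝ} (ht : 0 < t) :
    ∫⁻ x, P.shadowLaw j {s | P.lossAt j x s < t} ∂P.intensityMeasure j =
      ENNReal.ofReal (P.lamBS * P.M j t) := by
  have hS : MeasurableSet {p : Plane × ℝ | P.lossAt j p.1 p.2 < t} :=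
    measurableSet_lt (P.measurable_lossAt j) measurable_const
  have h1 := Measure.prod_apply (μ := P.intensityMeasure j) (ν := P.shadowLaw j) hS
  have h2 := Measure.prod_apply_symm (μ := P.intensityMeasure j) (ν := P.shadowLaw j) hS
  refine h1.symm.trans (h2.trans ?_)
  rw [P.shadowLaw_eq, lintegral_map (measurable_measure_prodMk_right hS) (measurable_const_mul _),
    ← P.integral_ballMean j ht, ofReal_integral_eq_lintegral_ofReal (P.integrable_ballMean j ht)
      (ae_of_all _ fun z => P.ballMean_nonneg j (P.radius_pos j t z).le)]
  refine lintegral_congr fun z => ?_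
  rw [← P.intensityMeasure_ball j (P.radius_pos j t z).le]
  refine measure_congr ?_
  filter_upwards [measure_eq_zero_iff_ae_notMem.1 (P.intensityMeasure_zero j)] with x hx
  exact propext (by
    refine (P.lossAt_lt_iff j (by simpa using hx) ht z).trans ?_
    exact mem_ball_zero_iff.symm)

end Params

/-! ### Small scale fading -/

lemma gaussianPDF_half_mul (x y : ℝ) :
    gaussianPDF 0 (1 / 2) x * gaussianPDF 0 (1 / 2) y =
      ENNReal.ofReal (Real.pi⁻¹ * Real.exp (-(x ^ 2 + y ^ 2))) := by
  rw [gaussianPDF, gaussianPDF, ← ENNReal.ofReal_mul (gaussianPDFReal_nonneg _ _ _),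
    gaussianPDFReal_def]
  congr 1
  have h : 2 * Real.pi * ((1 / 2 : ℝ≥0) : ℝ) = Real.pi := by
    push_cast
    ring
  have h2 : √Real.pi * √Real.pi = Real.pi := Real.mul_self_sqrt Real.pi_nonneg
  simp only [h, sub_zero]
  rw [mul_mul_mul_comm, ← Real.exp_add, ← mul_inv, h2]
  congr 2
  push_cast
  ring

lemma lintegral_radial_tail {s : ℝ} (hs : 0 ≤ s) :
    ∫⁻ r in Ioi (√s), ENNReal.ofReal (2 * r * Real.exp (-r ^ 2)) = ENNReal.ofReal (Real.exp (-s)) := by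
  have hd : ∀ r ∈ Ici (√s), HasDerivAt (fun r : ℝ => -Real.exp (-r ^ 2))
      (2 * r * Real.exp (-r ^ 2)) r := by
    intro r _
    have := ((hasDerivAt_pow 2 r).neg.exp).neg
    refine this.congr_deriv ?_
    simp only [Pi.neg_apply]
    push_cast
    ring
  have hpos : ∀ r ∈ Ioi (√s), 0 ≤ 2 * r * Real.exp (-r ^ 2) := by
    intro r hr
    have : 0 < r := (Real.sqrt_nonneg s).trans_lt hr
    positivity
  have hlim : Tendsto (fun r : ℝ => -Real.exp (-r ^ 2)) atTop (𝓝 0) := by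
    rw [← neg_zero]
    refine (Real.tendsto_exp_atBot.comp ?_).neg
    exact tendsto_neg_atTop_atBot.comp (tendsto_pow_atTop two_ne_zero)
  have hint := integrableOn_Ioi_deriv_of_nonneg' hd hpos hlim
  rw [← ofReal_integral_eq_lintegral_ofReal hint
    ((ae_restrict_iff' measurableSet_Ioi).2 (ae_of_all _ hpos)),
    integral_Ioi_of_hasDerivAt_of_nonneg' hd hpos hlim, Real.sq_sqrt hs]
  simp

/-- The squared modulus is standard exponential: in polar coordinates the density π⁻¹ e^{-r²} is
radial, and the angle contributes 2π. -/
lemma complexNormal_normSq_gt {s : ℝ} (hs : 0 ≤ s) :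
    complexNormal {z | s < ‖z‖ ^ 2} = ENNReal.ofReal (Real.exp (-s)) := by
  have hmeas : MeasurableSet {z : ℂ | s < ‖z‖ ^ 2} :=
    measurableSet_lt measurable_const (by fun_prop)
  have hmap : Measurable fun z : ℝ × ℝ => (⟨z.1, z.2⟩ : ℂ) :=
    Complex.measurableEquivRealProd.symm.measurable
  have hA : MeasurableSet {z : ℝ × ℝ | s < z.1 ^ 2 + z.2 ^ 2} :=
    measurableSet_lt measurable_const (by fun_prop)
  have hpre : (fun z : ℝ × ℝ => (⟨z.1, z.2⟩ : ℂ)) ⁻¹' {z | s < ‖z‖ ^ 2} =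
      {z : ℝ × ℝ | s < z.1 ^ 2 + z.2 ^ 2} := by
    ext z
    simp only [mem_preimage, mem_ofPred_eq, Complex.sq_norm, Complex.normSq_mk, ← sq]
  rw [complexNormal, Measure.map_apply hmap hmeas, hpre,
    gaussianReal_of_var_ne_zero _ (by norm_num), prod_withDensity (measurable_gaussianPDF _ _)
      (measurable_gaussianPDF _ _), withDensity_apply _ hA, ← lintegral_indicator hA,
    ← Measure.volume_eq_prod, ← lintegral_comp_polarCoord_symm]
  have htarget : polarCoord.target = Ioi (0 : ℝ) ×ˢ Ioo (-Real.pi) Real.pi := rfl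
  have hint : ∀ p ∈ polarCoord.target, ENNReal.ofReal p.1 •
      {z : ℝ × ℝ | s < z.1 ^ 2 + z.2 ^ 2}.indicator
        (fun z => gaussianPDF 0 (1 / 2) z.1 * gaussianPDF 0 (1 / 2) z.2) (polarCoord.symm p) =
      (Ioi (√s)).indicator
        (fun r => ENNReal.ofReal (r * (Real.pi⁻¹ * Real.exp (-r ^ 2)))) p.1 := by
    intro p hp
    have hp0 : 0 < p.1 := hp.1
    have hsq : (p.1 * Real.cos p.2) ^ 2 + (p.1 * Real.sin p.2) ^ 2 = p.1 ^ 2 := by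
      rw [mul_pow, mul_pow, ← mul_add, Real.cos_sq_add_sin_sq, mul_one]
    simp only [polarCoord_symm_apply, indicator, mem_ofPred_eq, mem_Ioi, hsq,
      gaussianPDF_half_mul, Real.sqrt_lt' hp0, smul_eq_mul, mul_ite, mul_zero]
    rw [← ENNReal.ofReal_mul hp0.le]
  rw [setLIntegral_congr_fun polarCoord.open_target.measurableSet hint, htarget,
    Measure.volume_eq_prod, setLIntegral_prod]
  · simp only [setLIntegral_const, Real.volume_Ioo]
    rw [lintegral_mul_const', lintegral_indicator measurableSet_Ioi, Measure.restrict_restrict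
      measurableSet_Ioi, inter_eq_left.2 (Ioi_subset_Ioi (Real.sqrt_nonneg s)),
      ← lintegral_radial_tail hs, ← lintegral_mul_const' _ _ ENNReal.ofReal_ne_top]
    · refine setLIntegral_congr_fun measurableSet_Ioi fun r hr => ?_
      have : 0 < r := (Real.sqrt_nonneg s).trans_lt hr
      rw [← ENNReal.ofReal_mul (by positivity)]
      congr 1
      field_simp
      ring
    · exact ENNReal.ofReal_ne_top
  · refine Measurable.aemeasurable ?_
    exact (Measurable.indicator (by fun_prop) measurableSet_Ioi).comp measurable_fst

/-- Binomial theorem; the term k = 0 cancels the leading 1, and the shift of the index flips the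
sign. This is the source of the alternating sum in the coverage formula. -/
lemma one_sub_one_sub_exp_pow (n : ℕ) (c : ℝ) :
    1 - (1 - Real.exp (-c)) ^ n =
      ∑ k ∈ Finset.Icc 1 n, (-1) ^ (k + 1) * (n.choose k : ℝ) * Real.exp (-(k * c)) := by
  have h : (1 - Real.exp (-c)) ^ n =
      ∑ k ∈ Finset.range (n + 1), (-1) ^ k * (n.choose k : ℝ) * Real.exp (-(k * c)) := by
    rw [sub_eq_neg_add, add_pow]
    refine Finset.sum_congr rfl fun k _ => ?_
    rw [neg_pow, ← Real.exp_nat_mul, one_pow]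
    ring_nf
  rw [h, Finset.sum_range_succ', Finset.range_eq_Ico, Finset.sum_Ico_add' (fun k =>
    (-1 : ℝ) ^ k * (n.choose k : ℝ) * Real.exp (-(k * c))) 0 n 1]
  simp only [pow_zero, Nat.choose_zero_right, Nat.cast_zero, zero_mul, neg_zero, Real.exp_zero,
    Nat.cast_one, mul_one]
  rw [sub_add_cancel_right, ← Finset.sum_neg_distrib]
  refine Finset.sum_congr (by ext; simp) fun k _ => ?_
  rw [pow_succ]
  ring

lemma measure_iSup_normSq_gt {Ω : Type*} [MeasurableSpace Ω] {μ : Measure Ω} [IsProbabilityMeasure μ]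
    {n : ℕ} (hn : 1 ≤ n) {X : Fin n → Ω → ℂ} (hX : ∀ k, Measurable (X k)) (hind : iIndepFun X μ)
    (hlaw : ∀ k, μ.map (X k) = complexNormal) {c : ℝ} (hc : 0 ≤ c) :
    μ {ω | c < ⨆ k, ‖X k ω‖ ^ 2} = ENNReal.ofReal (1 - (1 - Real.exp (-c)) ^ n) := by
  have : Nonempty (Fin n) := ⟨⟨0, hn⟩⟩
  have he : Real.exp (-c) ≤ 1 := Real.exp_le_one_iff.2 (by linarith)
  have hset : {ω | c < ⨆ k, ‖X k ω‖ ^ 2} =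
      (⋂ k ∈ (Finset.univ : Finset (Fin n)), X k ⁻¹' {z | c < ‖z‖ ^ 2}ᶜ)ᶜ := by
    ext ω
    rw [mem_compl_iff, mem_ofPred_eq, ← not_le, ciSup_le_iff (Set.finite_range _).bddAbove]
    simp
  have hm : MeasurableSet {z : ℂ | c < ‖z‖ ^ 2}ᶜ :=
    (measurableSet_lt measurable_const (by fun_prop)).compl
  have hp : ∀ k, μ (X k ⁻¹' {z | c < ‖z‖ ^ 2}ᶜ) = ENNReal.ofReal (1 - Real.exp (-c)) := by
    intro k
    have : IsProbabilityMeasure complexNormal :=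
      hlaw k ▸ Measure.isProbabilityMeasure_map (hX k).aemeasurable
    rw [← Measure.map_apply (hX k) hm, hlaw k, prob_compl_eq_one_sub hm.of_compl,
      complexNormal_normSq_gt hc, ENNReal.ofReal_sub _ (Real.exp_pos _).le, ENNReal.ofReal_one]
  rw [hset, prob_compl_eq_one_sub (Finset.measurableSet_biInter _ fun k _ => hX k hm),
    hind.measure_inter_preimage_eq_mul Finset.univ fun _ _ => hm]
  simp_rw [hp]
  rw [Finset.prod_const, Finset.card_univ, Fintype.card_fin,
    ← ENNReal.ofReal_pow (sub_nonneg.2 he), ENNReal.ofReal_sub _ (pow_nonneg (sub_nonneg.2 he) n),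
    ENNReal.ofReal_one]

/-! ### Independence -/

/-- Conditioning on a σ-algebra `m₁`, a variable `S` that is independent of it can be integrated
out. -/
lemma lintegral_mul_comp_of_indep {Ω E F : Type*} {m₁ m₂ m : MeasurableSpace Ω} [MeasurableSpace E]
    [MeasurableSpace F] {μ : Measure Ω} [IsFiniteMeasure μ] (h₁ : m₁ ≤ m) (h₂ : m₂ ≤ m)
    (hind : Indep m₁ m₂ μ) {A : Ω → ℝ≥0∞} (hA : Measurable[m₁] A) {X : Ω → E}
    (hX : Measurable[m₁] X) {S : Ω → F} (hS : Measurable[m₂] S) {φ : E × F → ℝ≥0∞}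
    (hφ : Measurable φ) :
    ∫⁻ ω, A ω * φ (X ω, S ω) ∂μ = ∫⁻ ω, A ω * ∫⁻ s, φ (X ω, s) ∂μ.map S ∂μ := by
  have hA' : Measurable A := hA.mono h₁ le_rfl
  have hX' : Measurable X := hX.mono h₁ le_rfl
  have hS' : Measurable S := hS.mono h₂ le_rfl
  have hAX : Measurable[m₁] fun ω => (A ω, X ω) := hA.prodMk hX
  -- The weight `A` may depend on `X`, so independence of `S` is used for the pair `(A, X)` before
  -- Tonelli.
  have hpair : IndepFun (fun ω => (A ω, X ω)) S μ := by
    rw [IndepFun_iff_Indep]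
    exact indep_of_indep_of_le_left (indep_of_indep_of_le_right hind hS.comap_le) hAX.comap_le
  have hprod := (indepFun_iff_map_prod_eq_prod_map_map (hA'.prodMk hX').aemeasurable
    hS'.aemeasurable).1 hpair
  have hψ : Measurable fun p : (ℝ≥0∞ × E) × F => p.1.1 * φ (p.1.2, p.2) :=
    measurable_fst.fst.mul (hφ.comp (measurable_fst.snd.prodMk measurable_snd))
  calc ∫⁻ ω, A ω * φ (X ω, S ω) ∂μ
      = ∫⁻ p, p.1.1 * φ (p.1.2, p.2) ∂μ.map (fun ω => ((A ω, X ω), S ω)) :=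
        (lintegral_map hψ ((hA'.prodMk hX').prodMk hS')).symm
    _ = ∫⁻ q, ∫⁻ s, q.1 * φ (q.2, s) ∂μ.map S ∂μ.map (fun ω => (A ω, X ω)) := by
        rw [hprod, lintegral_prod _ hψ.aemeasurable]
    _ = ∫⁻ ω, ∫⁻ s, A ω * φ (X ω, s) ∂μ.map S ∂μ :=
        lintegral_map (Measurable.lintegral_prod_right' hψ) (hA'.prodMk hX')
    _ = _ := lintegral_congr fun ω => lintegral_const_mul _ (hφ.comp measurable_prodMk_left)

lemma countable_linkType : Countable LinkType := by
  refine Function.Injective.countable (f := fun j : LinkType => (LinkType.rec 0 1 j : ℕ)) ?_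
  rintro (_ | _) (_ | _) h <;> simp_all

/-! ### σ-algebras generated by sets of sources -/

namespace Network

variable {P : Params} {Ω : Type*} {net : Network P Ω}

/-- The σ-algebra generated by a set of sources of randomness. -/
@[reducible] def algebra (net : Network P Ω) (S : Set (Source P)) : MeasurableSpace Ω :=
  ⨆ s ∈ S, net.sourceAlgebra s

lemma sourceAlgebra_le_algebra {S : Set (Source P)} {s : Source P} (hs : s ∈ S) :
    net.sourceAlgebra s ≤ net.algebra S :=
  le_iSup₂ (f := fun s (_ : s ∈ S) => net.sourceAlgebra s) s hs

lemma algebra_mono {S T : Set (Source P)} (h : S ⊆ T) : net.algebra S ≤ net.algebra T :=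
  iSup₂_le fun _ hs => sourceAlgebra_le_algebra (h hs)

lemma pathLoss_eq (net : Network P Ω) (j : LinkType) (i : ℕ) (ω : Ω) :
    net.pathLoss j i ω = P.lossAt j (net.loc j i ω) (net.shadow j i ω) := by
  unfold pathLoss pathLossDB Params.lossAt
  rfl

section Measurable

variable {S : Set (Source P)} {j : LinkType}

lemma measurable_algebra_num (h : .process j ∈ S) : Measurable[net.algebra S] (net.num j) :=
  (comap_measurable (net.num j)).mono
    ((le_sup_left : _ ≤ net.sourceAlgebra (.process j)).trans (sourceAlgebra_le_algebra h)) le_rfl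

lemma measurable_algebra_loc (h : .process j ∈ S) (i : ℕ) : Measurable[net.algebra S] (net.loc j i) :=
  (comap_measurable (net.loc j i)).mono
    (((le_iSup (fun i => MeasurableSpace.comap (net.loc j i) inferInstance) i).trans
      (le_sup_right : _ ≤ net.sourceAlgebra (.process j))).trans (sourceAlgebra_le_algebra h)) le_rfl

lemma measurable_algebra_shadow {i : ℕ} (h : .shadow j i ∈ S) :
    Measurable[net.algebra S] (net.shadow j i) :=
  (comap_measurable (net.shadow j i)).mono (sourceAlgebra_le_algebra h) le_rfl

lemma measurable_algebra_fading {i : ℕ} {k : Fin (P.eta j)} (h : .fading j i k ∈ S) :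
    Measurable[net.algebra S] (net.fading j i k) :=
  (comap_measurable (net.fading j i k)).mono (sourceAlgebra_le_algebra h) le_rfl

lemma measurable_algebra_load (h : .load ∈ S) : Measurable[net.algebra S] net.load :=
  (comap_measurable net.load).mono (sourceAlgebra_le_algebra h) le_rfl

lemma measurable_algebra_penalty (h : .penalty ∈ S) (u : ℕ) :
    Measurable[net.algebra S] (net.penalty j u) :=
  (comap_measurable (net.penalty j u)).mono
    (((le_iSup (fun u => MeasurableSpace.comap (net.penalty j u) inferInstance) u).trans
      (le_iSup (fun j => ⨆ u, MeasurableSpace.comap (net.penalty j u) inferInstance) j)).trans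
        (sourceAlgebra_le_algebra h)) le_rfl

lemma measurable_algebra_pathLoss {i : ℕ} (h : .process j ∈ S) (h' : .shadow j i ∈ S) :
    Measurable[net.algebra S] (net.pathLoss j i) := by
  rw [show net.pathLoss j i = fun ω => P.lossAt j (net.loc j i ω) (net.shadow j i ω) from
    funext fun ω => net.pathLoss_eq j i ω]
  exact (P.measurable_lossAt j).comp ((measurable_algebra_loc h i).prodMk (measurable_algebra_shadow h'))

lemma measurableSet_lt_num (h : .process j ∈ S) (i : ℕ) :
    MeasurableSet[net.algebra S] {ω | (i : ℕ∞) < net.num j ω} :=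
  measurable_algebra_num h (MeasurableSet.of_discrete (s := Ioi (i : ℕ∞)))

end Measurable

lemma pathLoss_pos (j : LinkType) (i : ℕ) (ω : Ω) : 0 < net.pathLoss j i ω := by
  rw [pathLoss_eq]
  exact P.lossAt_pos j _ _

variable [MeasurableSpace Ω] {μ : Measure Ω}

lemma IsModel.sourceAlgebra_le (h : net.IsModel μ) (s : Source P) :
    net.sourceAlgebra s ≤ ‹MeasurableSpace Ω› := by
  cases s with
  | process j =>
    exact sup_le (h.poisson j).measurable_num.comap_le
      (iSup_le fun i => ((h.poisson j).measurable_loc i).comap_le)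
  | shadow j i => exact (h.measurable_shadow j i).comap_le
  | fading j i k => exact (h.measurable_fading j i k).comap_le
  | load => exact h.measurable_load.comap_le
  | penalty =>
    exact iSup_le fun j => iSup_le fun u => (h.measurable_penalty j u).comap_le

lemma IsModel.algebra_le (h : net.IsModel μ) (S : Set (Source P)) :
    net.algebra S ≤ ‹MeasurableSpace Ω› :=
  iSup₂_le fun s _ => h.sourceAlgebra_le s

lemma IsModel.indep_algebra (h : net.IsModel μ) {S T : Set (Source P)} (hST : Disjoint S T) :
    Indep (net.algebra S) (net.algebra T) μ :=
  indep_iSup_of_disjoint h.sourceAlgebra_le h.indep hST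

lemma IsModel.measurable_pathLoss (h : net.IsModel μ) (j : LinkType) (i : ℕ) :
    Measurable (net.pathLoss j i) :=
  (measurable_algebra_pathLoss (mem_univ _) (mem_univ _)).mono (h.algebra_le univ) le_rfl

variable [IsProbabilityMeasure μ]

/-! ### Void probabilities of the path loss process -/

/-- Induction on the number of marks: the last shadowing is independent of the process and of the
earlier shadowings, so it can be averaged out. The averaged factor depends on the process alone and
is absorbed into `B`, which is why `B` is kept general. -/
lemma IsModel.lintegral_marked_prod (h : net.IsModel μ) (j : LinkType) {φ : Plane × ℝ → ℝ≥0∞}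
    (hφ : Measurable φ) (n : ℕ) {B : Ω → ℝ≥0∞} (hB : Measurable[net.algebra {.process j}] B) :
    ∫⁻ ω, (∏ i ∈ Finset.range n, if (i : ℕ∞) < net.num j ω then
        φ (net.loc j i ω, net.shadow j i ω) else 1) * B ω ∂μ =
      ∫⁻ ω, (∏ i ∈ Finset.range n, if (i : ℕ∞) < net.num j ω then
        ∫⁻ s, φ (net.loc j i ω, s) ∂P.shadowLaw j else 1) * B ω ∂μ := by
  induction n generalizing B with
  | zero => simp
  | succ n ih =>
    set S : Set (Source P) := {s | s = .process j ∨ ∃ i < n, s = .shadow j i} with hS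
    have hSp : .process j ∈ S := Or.inl rfl
    have hSs : ∀ i < n, .shadow j i ∈ S := fun i hi => Or.inr ⟨i, hi, rfl⟩
    have hdisj : Disjoint S {.shadow j n} := by
      rw [Set.disjoint_singleton_right]
      rintro (h | ⟨i, hi, h⟩)
      · cases h
      · cases h
        exact lt_irrefl _ hi
    have hA : Measurable[net.algebra S] fun ω =>
        (∏ i ∈ Finset.range n, if (i : ℕ∞) < net.num j ω then
          φ (net.loc j i ω, net.shadow j i ω) else 1) * B ω := by
      refine Measurable.mul (Finset.measurable_prod _ fun i hi => ?_)
        (hB.mono (algebra_mono (singleton_subset_iff.2 hSp)) le_rfl)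
      exact Measurable.ite (measurableSet_lt_num hSp i)
        (hφ.comp ((measurable_algebra_loc hSp i).prodMk (measurable_algebra_shadow (hSs i (Finset.mem_range.1 hi)))))
        measurable_const
    have hψ : Measurable fun p : (ℕ∞ × Plane) × ℝ =>
        if (n : ℕ∞) < p.1.1 then φ (p.1.2, p.2) else 1 :=
      Measurable.ite (measurable_fst.fst (MeasurableSet.of_discrete (s := Ioi (n : ℕ∞))))
        (hφ.comp (measurable_fst.snd.prodMk measurable_snd)) measurable_const
    have key := lintegral_mul_comp_of_indep (h.algebra_le _) (h.algebra_le _)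
      (h.indep_algebra hdisj) hA ((measurable_algebra_num hSp).prodMk (measurable_algebra_loc hSp n))
      (measurable_algebra_shadow (mem_singleton _)) hψ
    have hB' : Measurable[net.algebra {.process j}] fun ω =>
        (if (n : ℕ∞) < net.num j ω then ∫⁻ s, φ (net.loc j n ω, s) ∂P.shadowLaw j else 1) * B ω :=
      (Measurable.ite (measurableSet_lt_num (mem_singleton _) n)
        (hφ.lintegral_prod_right'.comp (measurable_algebra_loc (mem_singleton _) n)) measurable_const).mul hB
    have hl : ∀ ω, (∏ i ∈ Finset.range (n + 1), if (i : ℕ∞) < net.num j ω then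
        φ (net.loc j i ω, net.shadow j i ω) else 1) * B ω =
        ((∏ i ∈ Finset.range n, if (i : ℕ∞) < net.num j ω then
          φ (net.loc j i ω, net.shadow j i ω) else 1) * B ω) *
          (if (n : ℕ∞) < net.num j ω then φ (net.loc j n ω, net.shadow j n ω) else 1) := fun ω => by
      rw [Finset.prod_range_succ]
      ring
    have hr : ∀ ω, (∏ i ∈ Finset.range (n + 1), if (i : ℕ∞) < net.num j ω then
        ∫⁻ s, φ (net.loc j i ω, s) ∂P.shadowLaw j else 1) * B ω =
        (∏ i ∈ Finset.range n, if (i : ℕ∞) < net.num j ω then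
          ∫⁻ s, φ (net.loc j i ω, s) ∂P.shadowLaw j else 1) *
          ((if (n : ℕ∞) < net.num j ω then ∫⁻ s, φ (net.loc j n ω, s) ∂P.shadowLaw j else 1) *
            B ω) := fun ω => by
      rw [Finset.prod_range_succ]
      ring
    simp_rw [hl, hr]
    rw [← ih hB', key, h.map_shadow]
    refine lintegral_congr fun ω => ?_
    simp only
    by_cases hn : (n : ℕ∞) < net.num j ω
    · simp only [hn, if_true]
      ring
    · simp [hn]

/-- The probability that all path losses of type `j` are at least `t`. -/
lemma IsModel.measure_forall_le_pathLoss (h : net.IsModel μ) (j : LinkType) {t : ℝ} (ht : 0 < t) :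
    μ {ω | ∀ i : ℕ, (i : ℕ∞) < net.num j ω → t ≤ net.pathLoss j i ω} =
      ENNReal.ofReal (Real.exp (-(P.lamBS * P.M j t))) := by
  set V := {ω | ∀ i : ℕ, (i : ℕ∞) < net.num j ω → t ≤ net.pathLoss j i ω} with hV
  have hVm : MeasurableSet V := by
    have : V = ⋂ i : ℕ, {ω | (i : ℕ∞) < net.num j ω}ᶜ ∪ {ω | t ≤ net.pathLoss j i ω} := by
      ext ω
      simp [hV, imp_iff_not_or]
    rw [this]
    exact MeasurableSet.iInter fun i => ((h.poisson j).measurableSet_num i).compl.union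
      (measurableSet_le measurable_const (h.measurable_pathLoss j i))
  -- The void event has as indicator the product of `φ` over the marked points; averaging a mark
  -- replaces `φ` by `1 - g`.
  set φ : Plane × ℝ → ℝ≥0∞ := {p | t ≤ P.lossAt j p.1 p.2}.indicator fun _ => 1 with hφdef
  have hφs : MeasurableSet {p : Plane × ℝ | t ≤ P.lossAt j p.1 p.2} :=
    measurableSet_le measurable_const (P.measurable_lossAt j)
  have hφ : Measurable φ := measurable_const.indicator hφs
  set g : Plane → ℝ≥0∞ := fun x => P.shadowLaw j {s | P.lossAt j x s < t} with hg
  have hgm : Measurable g := P.measurable_shadowLaw_lossAt j t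
  have hφg : ∀ x, ∫⁻ s, φ (x, s) ∂P.shadowLaw j = 1 - g x := by
    intro x
    have hms : MeasurableSet {s | P.lossAt j x s < t} :=
      measurableSet_lt ((P.measurable_lossAt j).comp measurable_prodMk_left) measurable_const
    rw [hg, ← prob_compl_eq_one_sub hms, ← lintegral_indicator_one hms.compl]
    refine lintegral_congr fun s => ?_
    simp only [hφdef, indicator, mem_ofPred_eq, mem_compl_iff, not_lt, Pi.one_apply]
  have hind : ∀ ω, V.indicator (1 : Ω → ℝ≥0∞) ω = ⨅ n : ℕ, ∏ i ∈ Finset.range n,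
      if (i : ℕ∞) < net.num j ω then φ (net.loc j i ω, net.shadow j i ω) else 1 := by
    intro ω
    by_cases hω : ω ∈ V
    · rw [indicator_of_mem hω]
      have : ∀ n : ℕ, (∏ i ∈ Finset.range n, if (i : ℕ∞) < net.num j ω then
          φ (net.loc j i ω, net.shadow j i ω) else 1) = 1 := by
        intro n
        refine Finset.prod_eq_one fun i _ => ?_
        split_ifs with hi
        · have := hω i hi
          rw [pathLoss_eq] at this
          exact indicator_of_mem (s := {p : Plane × ℝ | t ≤ P.lossAt j p.1 p.2}) this _
        · rfl
      simp [this]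
    · rw [indicator_of_notMem hω]
      simp only [hV, mem_ofPred_eq, not_forall] at hω
      obtain ⟨i, hi, hlt⟩ := hω
      refine (le_antisymm (iInf_le_of_le (i + 1) ?_) zero_le).symm
      rw [Finset.prod_eq_zero (Finset.self_mem_range_succ i)]
      rw [if_pos hi]
      rw [pathLoss_eq] at hlt
      exact indicator_of_notMem (s := {p : Plane × ℝ | t ≤ P.lossAt j p.1 p.2}) hlt _
  have hlin := P.lintegral_shadowLaw_lossAt j ht
  have hpt := (h.poisson j).lintegral_pointProd hgm (fun x => prob_le_one)
    (by rw [hlin]; exact ENNReal.ofReal_ne_top)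
  rw [hlin, ENNReal.toReal_ofReal (P.lamBS_mul_M_nonneg j ht)] at hpt
  rw [← lintegral_indicator_one hVm, ← hpt]
  simp_rw [hind]
  have hanti1 : Antitone fun (n : ℕ) ω => ∏ i ∈ Finset.range n,
      if (i : ℕ∞) < net.num j ω then φ (net.loc j i ω, net.shadow j i ω) else 1 := by
    refine antitone_nat_of_succ_le fun n ω => ?_
    simp only
    rw [Finset.prod_range_succ]
    refine mul_le_of_le_one_right' ?_
    split_ifs
    · exact indicator_le_self' (fun _ _ => zero_le) _
    · exact le_rfl
  have hanti2 : Antitone fun (n : ℕ) ω => ∏ i ∈ Finset.range n,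
      if (i : ℕ∞) < net.num j ω then 1 - g (net.loc j i ω) else 1 := fun a b hab ω =>
    antitone_prod_points (net.num j) (net.loc j) (v := fun x => 1 - g x) (fun x => tsub_le_self) ω hab
  simp only [pointProd]
  have hm1 : ∀ n : ℕ, Measurable fun ω => ∏ i ∈ Finset.range n,
      if (i : ℕ∞) < net.num j ω then φ (net.loc j i ω, net.shadow j i ω) else 1 := fun n =>
    Finset.measurable_prod _ fun i _ => Measurable.ite ((h.poisson j).measurableSet_num i)
      (hφ.comp (((h.poisson j).measurable_loc i).prodMk (h.measurable_shadow j i))) measurable_const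
  -- Marks can be averaged only in finite products, so both infima are first taken out of the
  -- integrals.
  rw [lintegral_iInf hm1 hanti1 (by simp), lintegral_iInf
    (fun n => (h.poisson j).measurable_prod_points (v := fun x => 1 - g x)
      (measurable_const.sub hgm) n) hanti2 (by simp)]
  refine iInf_congr fun n => ?_
  have := h.lintegral_marked_prod j hφ n (B := fun _ => 1) measurable_const
  simp only [mul_one, hφg] at this
  exact this

/-! ### Almost sure properties of the path losses -/

/-- By Campbell's formula the probabilities that station i exists and has loss below `t` have the
finite sum λ_BS M_j(t); Borel–Cantelli concludes. -/
lemma IsModel.ae_finite_pathLoss_lt (h : net.IsModel μ) (j : LinkType) {t : ℝ} (ht : 0 < t) :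
    ∀ᵐ ω ∂μ, {i : ℕ | (i : ℕ∞) < net.num j ω ∧ net.pathLoss j i ω < t}.Finite := by
  refine ae_finite_setOfPred_mem (s := fun i : ℕ =>
    {ω | (i : ℕ∞) < net.num j ω ∧ net.pathLoss j i ω < t}) ?_
  have hφs : MeasurableSet {p : Plane × ℝ | P.lossAt j p.1 p.2 < t} :=
    measurableSet_lt (P.measurable_lossAt j) measurable_const
  have hcamp := (h.poisson j).tsum_lintegral (P.measurable_shadowLaw_lossAt j t)
  rw [P.lintegral_shadowLaw_lossAt j ht] at hcamp
  refine ne_of_eq_of_ne ?_ (hcamp ▸ ENNReal.ofReal_ne_top)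
  refine tsum_congr fun i => ?_
  have hm := (h.poisson j).measurableSet_num i
  have hdisj : Disjoint ({.process j} : Set (Source P)) {.shadow j i} := by simp
  have key := lintegral_mul_comp_of_indep (h.algebra_le _) (h.algebra_le _) (h.indep_algebra hdisj)
    (A := {ω | (i : ℕ∞) < net.num j ω}.indicator fun _ => 1)
    (measurable_const.indicator (measurableSet_lt_num (mem_singleton _) i))
    (measurable_algebra_loc (mem_singleton _) i) (measurable_algebra_shadow (mem_singleton _))
    (φ := {p : Plane × ℝ | P.lossAt j p.1 p.2 < t}.indicator 1) (measurable_one.indicator hφs)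
  rw [h.map_shadow] at key
  have h1 : MeasurableSet {ω | (i : ℕ∞) < net.num j ω ∧ net.pathLoss j i ω < t} :=
    hm.inter (measurableSet_lt (h.measurable_pathLoss j i) measurable_const)
  rw [← lintegral_indicator hm, ← lintegral_indicator_one h1]
  refine Eq.trans (lintegral_congr fun ω => ?_) (key.trans (lintegral_congr fun ω => ?_))
  · by_cases hi : (i : ℕ∞) < net.num j ω
    · simp only [indicator, mem_ofPred_eq, hi, true_and, if_true, Pi.one_apply, one_mul,
        pathLoss_eq]
    · simp [indicator, hi]
  · by_cases hi : (i : ℕ∞) < net.num j ω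
    · simp only [indicator, mem_ofPred_eq, hi, if_true, Pi.one_apply, one_mul]
      have hms : MeasurableSet {s | P.lossAt j (net.loc j i ω) s < t} :=
        measurableSet_lt ((P.measurable_lossAt j).comp measurable_prodMk_left) measurable_const
      rw [← lintegral_indicator_one hms]
      rfl
    · simp [indicator, hi]

/-- Given everything except the shadowing of one link, a tie fixes that shadowing to at most one
value, as the loss is injective in it. Its Gaussian law has no atoms. -/
lemma IsModel.ae_pathLoss_ne (h : net.IsModel μ) :
    ∀ᵐ ω ∂μ, ∀ b b' : LinkType × ℕ, b ≠ b' → net.pathLoss b.1 b.2 ω ≠ net.pathLoss b'.1 b'.2 ω := by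
  have := countable_linkType
  simp_rw [ae_all_iff]
  rintro ⟨j, i⟩ ⟨j', i'⟩ hne
  set S : Set (Source P) := {.shadow j i}ᶜ with hS
  have hdisj : Disjoint S {.shadow j i} := disjoint_compl_left
  have hφs : MeasurableSet {p : (Plane × ℝ) × ℝ | P.lossAt j p.1.1 p.2 = p.1.2} :=
    measurableSet_eq_fun ((P.measurable_lossAt j).comp (measurable_fst.fst.prodMk measurable_snd))
      measurable_fst.snd
  have hS' : .shadow j' i' ∈ S := by
    simp only [hS, mem_compl_iff, mem_singleton_iff, Source.shadow.injEq]
    rintro ⟨rfl, rfl⟩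
    exact hne rfl
  have hX : Measurable[net.algebra S] fun ω => (net.loc j i ω, net.pathLoss j' i' ω) :=
    (measurable_algebra_loc (by simp [hS]) i).prodMk (measurable_algebra_pathLoss (by simp [hS]) hS')
  have key := lintegral_mul_comp_of_indep (h.algebra_le _) (h.algebra_le _) (h.indep_algebra hdisj)
    (A := fun _ => 1) measurable_const hX (measurable_algebra_shadow (mem_singleton _))
    (φ := {p : (Plane × ℝ) × ℝ | P.lossAt j p.1.1 p.2 = p.1.2}.indicator 1)
    (measurable_one.indicator hφs)
  rw [h.map_shadow] at key
  have hzero : ∀ (x : Plane) (l : ℝ), P.shadowLaw j {s | P.lossAt j x s = l} = 0 := by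
    intro x l
    have : NullSingletonClass (P.shadowLaw j) :=
      nullSingletonClass_gaussianReal (by simpa using (P.xi_pos j).ne')
    refine Set.Subsingleton.measure_zero ?_ _
    intro s hs s' hs'
    exact P.lossAt_inj j x (hs.trans hs'.symm)
  change μ {ω | ¬ (net.pathLoss j i ω ≠ net.pathLoss j' i' ω)} = 0
  simp only [not_not]
  have h1 : MeasurableSet {ω | net.pathLoss j i ω = net.pathLoss j' i' ω} :=
    measurableSet_eq_fun (h.measurable_pathLoss j i) (h.measurable_pathLoss j' i')
  rw [← lintegral_indicator_one h1]
  refine Eq.trans (lintegral_congr fun ω => ?_) (key.trans ?_)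
  · simp only [indicator, mem_ofPred_eq, Pi.one_apply, one_mul, net.pathLoss_eq j i]
  · refine (lintegral_congr fun ω => ?_).trans lintegral_zero
    have hms : MeasurableSet {s | P.lossAt j (net.loc j i ω) s = net.pathLoss j' i' ω} :=
      measurableSet_eq_fun ((P.measurable_lossAt j).comp measurable_prodMk_left) measurable_const
    rw [one_mul, ← hzero (net.loc j i ω) (net.pathLoss j' i' ω),
      ← lintegral_indicator_one hms]
    rfl

/-- Without NLOS stations all NLOS losses are vacuously at least `t`, which has probability
exp(-λ_BS M(t)). This tends to 0 because `M` is unbounded. -/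
lemma IsModel.ae_num_NLOS_pos (h : net.IsModel μ) : ∀ᵐ ω ∂μ, (0 : ℕ∞) < net.num .NLOS ω := by
  change μ {ω | ¬ (0 : ℕ∞) < net.num .NLOS ω} = 0
  have hlim : Tendsto (fun t => ENNReal.ofReal (Real.exp (-(P.lamBS * P.M .NLOS t)))) atTop (𝓝 0) := by
    rw [← ENNReal.ofReal_zero]
    refine ENNReal.tendsto_ofReal (Real.tendsto_exp_atBot.comp (tendsto_neg_atTop_atBot.comp ?_))
    exact P.tendsto_M_NLOS.const_mul_atTop P.lamBS_pos
  refine le_antisymm (ge_of_tendsto hlim ?_) zero_le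
  filter_upwards [eventually_gt_atTop 0] with t ht
  rw [← h.measure_forall_le_pathLoss .NLOS ht]
  refine measure_mono fun ω hω i hi => ?_
  rw [mem_ofPred_eq, not_lt, nonpos_iff_eq_zero] at hω
  rw [hω] at hi
  exact absurd hi not_lt_zero

end Network

/-! ### Density of the smallest path loss -/

namespace Params

variable (P : Params) (j : LinkType)

/-- The density of the smallest path loss of type `j`. -/
def lossDensity (t : ℝ) : ℝ := P.lamBS * Real.exp (-(P.lamBS * P.M j t)) * P.M' j t

lemma lossDensity_nonneg {t : ℝ} (ht : 0 < t) : 0 ≤ P.lossDensity j t := by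
  have := P.lamBS_pos
  have := P.M'_nonneg j ht
  unfold lossDensity
  positivity

lemma measurable_M : Measurable (P.M j) := by
  have hQ := continuous_gaussQ.measurable
  have hu : ∀ j, Measurable (P.upsilon j) := fun j => by
    unfold upsilon
    fun_prop
  cases j
  · have h1 := hQ.comp (hu .LOS)
    have h2 := hQ.comp ((hu .LOS).const_sub (2 * P.sigma .LOS ^ 2 / (P.alpha .LOS * P.sigma .LOS)))
    exact ((h1.const_mul _).add (((measurable_id.pow_const _).mul_const _).mul h2)).const_mul _
  · have h1 := hQ.comp (hu .NLOS)
    have h2 := hQ.comp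
      ((hu .NLOS).const_sub (2 * P.sigma .NLOS ^ 2 / (P.alpha .NLOS * P.sigma .NLOS)))
    exact (h1.const_mul _).add ((((measurable_id.pow_const _).const_mul _).mul_const _).mul
      ((h2.const_mul _).const_sub _))

lemma aemeasurable_M' : AEMeasurable (P.M' j) (volume.restrict (Ioi 0)) := by
  refine (measurable_deriv (P.M j)).aemeasurable.congr ?_
  filter_upwards [ae_restrict_mem measurableSet_Ioi] with t ht
  exact (P.hasDerivAt_M j ht).deriv

lemma aemeasurable_lossDensity : AEMeasurable (P.lossDensity j) (volume.restrict (Ioi 0)) :=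
  (((P.measurable_M j).const_mul _).neg.exp.const_mul _).aemeasurable.mul (P.aemeasurable_M' j)

lemma hasDerivAt_neg_exp_M {t : ℝ} (ht : 0 < t) :
    HasDerivAt (fun t => -Real.exp (-(P.lamBS * P.M j t))) (P.lossDensity j t) t := by
  refine (((P.hasDerivAt_M j ht).const_mul P.lamBS).neg.exp.neg).congr_deriv ?_
  simp only [lossDensity, Pi.neg_apply]
  ring

/-- Fundamental theorem of calculus for the void probability; the nonnegative sign of the density
supplies its integrability. -/
lemma setLIntegral_lossDensity {a b : ℝ} (ha : 0 < a) (hab : a ≤ b) :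
    ∫⁻ t in Ico a b, ENNReal.ofReal (P.lossDensity j t) =
      ENNReal.ofReal (Real.exp (-(P.lamBS * P.M j a)) - Real.exp (-(P.lamBS * P.M j b))) := by
  have hd : ∀ x ∈ Icc a b, HasDerivAt (fun t => -Real.exp (-(P.lamBS * P.M j t)))
      (P.lossDensity j x) x := fun x hx => P.hasDerivAt_neg_exp_M j (ha.trans_le hx.1)
  have hc : ContinuousOn (fun t => -Real.exp (-(P.lamBS * P.M j t))) (Icc a b) := fun x hx =>
    (hd x hx).continuousAt.continuousWithinAt
  have hd' := fun x (hx : x ∈ Ioo a b) => hd x (Ioo_subset_Icc_self hx)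
  have hint : IntegrableOn (P.lossDensity j) (Ioc a b) :=
    intervalIntegral.integrableOn_deriv_of_nonneg hc hd' fun x hx =>
      P.lossDensity_nonneg j (ha.trans hx.1)
  have hftc := intervalIntegral.integral_eq_sub_of_hasDerivAt_of_le hab hc hd'
    ((intervalIntegrable_iff_integrableOn_Ioc_of_le hab).2 hint)
  rw [intervalIntegral.integral_of_le hab] at hftc
  rw [setLIntegral_congr Ico_ae_eq_Ioc, ← ofReal_integral_eq_lintegral_ofReal hint
    ((ae_restrict_iff' measurableSet_Ioc).2 (ae_of_all _ fun x hx =>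
      P.lossDensity_nonneg j (ha.trans hx.1))), hftc]
  congr 1
  ring

end Params

lemma LinkType.other_ne (j : LinkType) : j.other ≠ j := by cases j <;> simp [LinkType.other]

lemma LinkType.eq_or_eq_other (j j' : LinkType) : j' = j ∨ j' = j.other := by
  cases j <;> cases j' <;> simp [LinkType.other]

namespace Network

variable {P : Params} {Ω : Type*} {net : Network P Ω}

/-! ### The smallest path loss -/

/-- The infimum of the path losses of the BSs of type `j`. -/
def minLoss (net : Network P Ω) (j : LinkType) (ω : Ω) : ℝ≥0∞ :=
  ⨅ i : ℕ, if (i : ℕ∞) < net.num j ω then ENNReal.ofReal (net.pathLoss j i ω) else ⊤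

lemma ofReal_le_minLoss_iff (j : LinkType) (ω : Ω) (t : ℝ) :
    ENNReal.ofReal t ≤ net.minLoss j ω ↔
      ∀ i : ℕ, (i : ℕ∞) < net.num j ω → t ≤ net.pathLoss j i ω := by
  rw [minLoss, le_iInf_iff]
  refine forall_congr' fun i => ?_
  split_ifs with h
  · rw [ENNReal.ofReal_le_ofReal_iff (pathLoss_pos j i ω).le]
    simp [h]
  · simp [h]

lemma minLoss_le {j : LinkType} {i : ℕ} {ω : Ω} (h : (i : ℕ∞) < net.num j ω) :
    net.minLoss j ω ≤ ENNReal.ofReal (net.pathLoss j i ω) :=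
  iInf_le_of_le i (by rw [if_pos h])

lemma measurable_algebra_minLoss {S : Set (Source P)} {j : LinkType} (h : .process j ∈ S)
    (h' : ∀ i, .shadow j i ∈ S) : Measurable[net.algebra S] (net.minLoss j) :=
  Measurable.iInf fun i => Measurable.ite (measurableSet_lt_num h i)
    (measurable_algebra_pathLoss h (h' i)).ennreal_ofReal measurable_const

/-- There is a BS, no two links have the same path loss, and a smallest path loss is attained among
the BSs of each type. -/
structure IsRegular (net : Network P Ω) (ω : Ω) : Prop where
  exists_min : ∀ j, (∃ i : ℕ, (i : ℕ∞) < net.num j ω) → ∃ i : ℕ, (i : ℕ∞) < net.num j ω ∧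
    ∀ i' : ℕ, (i' : ℕ∞) < net.num j ω → net.pathLoss j i ω ≤ net.pathLoss j i' ω
  pathLoss_ne : ∀ b b' : LinkType × ℕ, b ≠ b' → net.pathLoss b.1 b.2 ω ≠ net.pathLoss b'.1 b'.2 ω
  num_pos : (0 : ℕ∞) < net.num .NLOS ω

lemma exists_min_of_finite {j : LinkType} {ω : Ω}
    (hfin : ∀ n : ℕ, {i : ℕ | (i : ℕ∞) < net.num j ω ∧ net.pathLoss j i ω < n + 1}.Finite)
    (hex : ∃ i : ℕ, (i : ℕ∞) < net.num j ω) : ∃ i : ℕ, (i : ℕ∞) < net.num j ω ∧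
      ∀ i' : ℕ, (i' : ℕ∞) < net.num j ω → net.pathLoss j i ω ≤ net.pathLoss j i' ω := by
  obtain ⟨i₀, hi₀⟩ := hex
  obtain ⟨n, hn⟩ := exists_nat_gt (net.pathLoss j i₀ ω)
  obtain ⟨i, hi, hmin⟩ := Set.exists_min_image _ (fun i => net.pathLoss j i ω) (hfin n)
    ⟨i₀, hi₀, hn.trans (lt_add_one _)⟩
  refine ⟨i, hi.1, fun i' hi' => ?_⟩
  by_cases h : net.pathLoss j i' ω < n + 1
  · exact hmin i' ⟨hi', h⟩
  · exact hi.2.le.trans (not_lt.1 h)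

lemma IsTagged.minLoss_eq {j : LinkType} {i : ℕ} {ω : Ω} (h : net.IsTagged ω (j, i)) :
    net.minLoss j ω = ENNReal.ofReal (net.pathLoss j i ω) :=
  le_antisymm (minLoss_le h.1) ((ofReal_le_minLoss_iff j ω _).2 fun i' hi' => h.2 j i' hi')

lemma IsTagged.minLoss_le_minLoss {j : LinkType} {i : ℕ} {ω : Ω} (h : net.IsTagged ω (j, i))
    (j' : LinkType) : net.minLoss j ω ≤ net.minLoss j' ω := by
  rw [h.minLoss_eq]
  exact (ofReal_le_minLoss_iff j' ω _).2 fun i' hi' => h.2 j' i' hi'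

lemma IsRegular.tagged_unique {ω : Ω} (h : net.IsRegular ω) {b b' : LinkType × ℕ}
    (hb : net.IsTagged ω b) (hb' : net.IsTagged ω b') : b = b' := by
  by_contra hne
  exact h.pathLoss_ne b b' hne (le_antisymm (hb.2 _ _ hb'.1) (hb'.2 _ _ hb.1))

lemma IsRegular.exists_pathLoss_eq {ω : Ω} (h : net.IsRegular ω) {j : LinkType}
    (hj : net.minLoss j ω ≠ ⊤) : ∃ i : ℕ, (i : ℕ∞) < net.num j ω ∧
      net.minLoss j ω = ENNReal.ofReal (net.pathLoss j i ω) := by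
  have hex : ∃ i : ℕ, (i : ℕ∞) < net.num j ω := by
    by_contra hne
    push Not at hne
    refine hj (iInf_eq_top.2 fun i => if_neg (hne i).not_gt)
  obtain ⟨i, hi, hmin⟩ := h.exists_min j hex
  exact ⟨i, hi, le_antisymm (minLoss_le hi) ((ofReal_le_minLoss_iff j ω _).2 hmin)⟩

lemma IsRegular.exists_isTagged_of_le {ω : Ω} (h : net.IsRegular ω) {j : LinkType}
    (hj : net.minLoss j ω ≠ ⊤) (hle : net.minLoss j ω ≤ net.minLoss j.other ω) :
    ∃ i, net.IsTagged ω (j, i) := by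
  obtain ⟨i, hi, heq⟩ := h.exists_pathLoss_eq hj
  refine ⟨i, hi, fun j' i' hi' => ?_⟩
  have : net.minLoss j ω ≤ net.minLoss j' ω := by
    rcases LinkType.eq_or_eq_other j j' with rfl | rfl
    exacts [le_rfl, hle]
  rw [heq] at this
  exact (ofReal_le_minLoss_iff j' ω _).1 this i' hi'

lemma IsRegular.existsUnique_isTagged {ω : Ω} (h : net.IsRegular ω) :
    ∃! b, net.IsTagged ω b := by
  have hN : net.minLoss .NLOS ω ≠ ⊤ :=
    ne_top_of_le_ne_top ENNReal.ofReal_ne_top (minLoss_le (i := 0) (by exact_mod_cast h.num_pos))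
  obtain ⟨b, hb⟩ : ∃ b, net.IsTagged ω b := by
    rcases le_total (net.minLoss .NLOS ω) (net.minLoss .LOS ω) with hle | hle
    · obtain ⟨i, hi⟩ := h.exists_isTagged_of_le hN hle
      exact ⟨_, hi⟩
    · obtain ⟨i, hi⟩ := h.exists_isTagged_of_le (ne_top_of_le_ne_top hN hle) hle
      exact ⟨_, hi⟩
  exact ⟨b, hb, fun b' hb' => h.tagged_unique hb' hb⟩

open Classical in
-- At most one station is tagged, so the sum has at most one nonzero term. It becomes a function of
-- the two smallest losses, which are independent.
lemma IsRegular.tsum_isTagged {ω : Ω} (h : net.IsRegular ω) (j : LinkType) (f : ℝ → ℝ≥0∞) :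
    ∑' i, {ω | net.IsTagged ω (j, i)}.indicator (fun ω => f (net.pathLoss j i ω)) ω =
      if net.minLoss j ω ≠ ⊤ ∧ net.minLoss j ω ≤ net.minLoss j.other ω then
        f (net.minLoss j ω).toReal else 0 := by
  split_ifs with hj
  · obtain ⟨i, hi⟩ := h.exists_isTagged_of_le hj.1 hj.2
    rw [tsum_eq_single i]
    · rw [indicator_of_mem (by exact hi), hi.minLoss_eq,
        ENNReal.toReal_ofReal (pathLoss_pos j i ω).le]
    · intro i' hi'
      refine indicator_of_notMem (fun hmem => hi' ?_) _
      exact congrArg Prod.snd (h.tagged_unique hmem hi)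
  · refine ENNReal.tsum_eq_zero.2 fun i => indicator_of_notMem (fun hmem => hj ?_) _
    exact ⟨by rw [IsTagged.minLoss_eq hmem]; exact ENNReal.ofReal_ne_top,
      IsTagged.minLoss_le_minLoss hmem _⟩

/-- Locations and shadowing of the BSs of type `j`. -/
def geometry (P : Params) (j : LinkType) : Set (Source P) :=
  {s | s = .process j ∨ ∃ i, s = .shadow j i}

lemma disjoint_geometry (j : LinkType) : Disjoint (geometry P j) (geometry P j.other) := by
  have := LinkType.other_ne j
  rw [Set.disjoint_left]
  rintro s (rfl | ⟨i, rfl⟩) (h | ⟨i', h⟩) <;> injection h <;> exact this (by symm; assumption)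

lemma measurableSet_isTagged {S : Set (Source P)} (h : ∀ j, geometry P j ⊆ S) (b : LinkType × ℕ) :
    MeasurableSet[net.algebra S] {ω | net.IsTagged ω b} := by
  have hp : ∀ j, .process j ∈ S := fun j => h j (Or.inl rfl)
  have hs : ∀ j i, .shadow j i ∈ S := fun j i => h j (Or.inr ⟨i, rfl⟩)
  have hm := fun j i => measurable_algebra_pathLoss (net := net) (hp j) (hs j i)
  have : {ω | net.IsTagged ω b} = {ω | (b.2 : ℕ∞) < net.num b.1 ω} ∩
      ((⋂ i : ℕ, {ω | (i : ℕ∞) < net.num .LOS ω}ᶜ ∪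
        {ω | net.pathLoss b.1 b.2 ω ≤ net.pathLoss .LOS i ω}) ∩
      (⋂ i : ℕ, {ω | (i : ℕ∞) < net.num .NLOS ω}ᶜ ∪
        {ω | net.pathLoss b.1 b.2 ω ≤ net.pathLoss .NLOS i ω})) := by
    ext ω
    simp only [IsTagged, mem_inter_iff, mem_iInter, mem_union, mem_compl_iff, mem_ofPred_eq,
      ← imp_iff_not_or]
    refine and_congr_right fun _ => ⟨fun H => ⟨H .LOS, H .NLOS⟩, fun H j => ?_⟩
    cases j
    exacts [H.1, H.2]
  rw [this]
  refine (measurableSet_lt_num (hp _) _).inter (MeasurableSet.inter ?_ ?_)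
  · exact MeasurableSet.iInter fun i => (measurableSet_lt_num (hp _) i).compl.union
      (measurableSet_le (hm _ _) (hm _ _))
  · exact MeasurableSet.iInter fun i => (measurableSet_lt_num (hp _) i).compl.union
      (measurableSet_le (hm _ _) (hm _ _))

variable [MeasurableSpace Ω] {μ : Measure Ω}

lemma IsModel.measurable_minLoss (h : net.IsModel μ) (j : LinkType) : Measurable (net.minLoss j) :=
  (measurable_algebra_minLoss (mem_univ _) fun _ => mem_univ _).mono (h.algebra_le univ) le_rfl

variable [IsProbabilityMeasure μ]

lemma IsModel.ae_isRegular (h : net.IsModel μ) : ∀ᵐ ω ∂μ, net.IsRegular ω := by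
  have hf : ∀ j, ∀ᵐ ω ∂μ, ∀ n : ℕ,
      {i : ℕ | (i : ℕ∞) < net.num j ω ∧ net.pathLoss j i ω < n + 1}.Finite := fun j =>
    ae_all_iff.2 fun n => h.ae_finite_pathLoss_lt j (by positivity)
  filter_upwards [hf .LOS, hf .NLOS, h.ae_pathLoss_ne, h.ae_num_NLOS_pos] with ω h1 h2 h3 h4
  refine ⟨fun j hj => ?_, h3, h4⟩
  cases j
  exacts [exists_min_of_finite h1 hj, exists_min_of_finite h2 hj]

lemma IsModel.measure_ofReal_le_minLoss (h : net.IsModel μ) (j : LinkType) {t : ℝ} (ht : 0 < t) :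
    μ {ω | ENNReal.ofReal t ≤ net.minLoss j ω} =
      ENNReal.ofReal (Real.exp (-(P.lamBS * P.M j t))) := by
  simp_rw [ofReal_le_minLoss_iff]
  exact h.measure_forall_le_pathLoss j ht

/-- The law of the smallest path loss of type `j`, on the event that there is a BS of type `j`. -/
lemma IsModel.map_minLoss (h : net.IsModel μ) (j : LinkType) :
    (μ.restrict {ω | net.minLoss j ω ≠ ⊤}).map (fun ω => (net.minLoss j ω).toReal) =
      (volume.restrict (Ioi 0)).withDensity fun t => ENNReal.ofReal (P.lossDensity j t) := by
  set ν := (μ.restrict {ω | net.minLoss j ω ≠ ⊤}).map (fun ω => (net.minLoss j ω).toReal) with hν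
  set D := (volume.restrict (Ioi 0)).withDensity fun t => ENNReal.ofReal (P.lossDensity j t) with hD
  have hm := h.measurable_minLoss j
  -- Away from 0, the mass of [a, b) is a difference of two void probabilities.
  have hpos : ∀ a b : ℝ, 0 < a → ν (Ico a b) = D (Ico a b) := by
    intro a b ha
    rcases lt_or_ge b a with hba | hab
    · simp [Ico_eq_empty hba.le.not_gt]
    have hset : (fun ω => (net.minLoss j ω).toReal) ⁻¹' Ico a b ∩ {ω | net.minLoss j ω ≠ ⊤} =
        {ω | ENNReal.ofReal a ≤ net.minLoss j ω} \ {ω | ENNReal.ofReal b ≤ net.minLoss j ω} := by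
      ext ω
      simp only [mem_inter_iff, mem_preimage, mem_Ico, mem_ofPred_eq, Set.mem_sdiff, not_le]
      constructor
      · rintro ⟨⟨h1, h2⟩, h3⟩
        exact ⟨(ENNReal.ofReal_le_iff_le_toReal h3).2 h1, (ENNReal.lt_ofReal_iff_toReal_lt h3).2 h2⟩
      · rintro ⟨h1, h2⟩
        have h3 := (h2.trans_le le_top).ne
        exact ⟨⟨(ENNReal.ofReal_le_iff_le_toReal h3).1 h1,
          (ENNReal.lt_ofReal_iff_toReal_lt h3).1 h2⟩, h3⟩
    have hsub : {ω | ENNReal.ofReal b ≤ net.minLoss j ω} ⊆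
        {ω | ENNReal.ofReal a ≤ net.minLoss j ω} := fun ω hω =>
      (ENNReal.ofReal_le_ofReal hab).trans hω
    rw [hν, Measure.map_apply hm.ennreal_toReal measurableSet_Ico,
      Measure.restrict_apply (hm.ennreal_toReal measurableSet_Ico), hset, measure_sdiff hsub
        (measurableSet_le measurable_const hm).nullMeasurableSet (measure_ne_top _ _),
      h.measure_ofReal_le_minLoss j ha, h.measure_ofReal_le_minLoss j (ha.trans_le hab), hD,
      withDensity_apply _ measurableSet_Ico, Measure.restrict_restrict measurableSet_Ico,
      inter_eq_left.2 fun x hx => mem_Ioi.2 (ha.trans_le hx.1), P.setLIntegral_lossDensity j ha hab,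
      ENNReal.ofReal_sub _ (Real.exp_pos _).le]
  have hν0 : ν (Iic 0) = 0 := by
    rw [hν, Measure.map_apply hm.ennreal_toReal measurableSet_Iic, measure_eq_zero_iff_ae_notMem]
    have hne : MeasurableSet {ω | net.minLoss j ω ≠ ⊤} := (hm (measurableSet_singleton ⊤)).compl
    rw [ae_restrict_iff' hne]
    filter_upwards [h.ae_isRegular] with ω hω hj
    obtain ⟨i, -, hi⟩ := hω.exists_pathLoss_eq hj
    rw [mem_preimage, mem_Iic, not_le, hi, ENNReal.toReal_ofReal (pathLoss_pos j i ω).le]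
    exact pathLoss_pos j i ω
  have hD0 : D (Iic 0) = 0 := by
    rw [hD, withDensity_apply _ measurableSet_Iic, Measure.restrict_restrict measurableSet_Iic,
      Iic_inter_Ioi, Ioc_self, Measure.restrict_empty, lintegral_zero_measure]
  refine Measure.ext_of_Ico' ν D (fun a b _ => measure_ne_top _ _) fun a b _ => ?_
  -- The void probability is known only for t > 0. As neither measure charges (-∞, 0], any [a, b) is
  -- exhausted by intervals whose left end is positive.
  have hcut : ∀ ρ : Measure ℝ, ρ (Iic 0) = 0 →
      Tendsto (fun n : ℕ => ρ (Ico (max a (1 / ((n : ℝ) + 1))) b)) atTop (𝓝 (ρ (Ico a b))) := by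
    intro ρ hρ
    have hmono : Monotone fun n : ℕ => Ico (max a (1 / ((n : ℝ) + 1))) b := fun n m hnm =>
      Ico_subset_Ico_left (max_le_max le_rfl (one_div_le_one_div_of_le (by positivity)
        (by exact_mod_cast Nat.succ_le_succ hnm)))
    have hU : (⋃ n : ℕ, Ico (max a (1 / ((n : ℝ) + 1))) b) = Ico a b ∩ Ioi 0 := by
      ext x
      simp only [mem_iUnion, mem_Ico, max_le_iff, mem_inter_iff, mem_Ioi]
      constructor
      · rintro ⟨n, ⟨h1, h2⟩, h3⟩
        exact ⟨⟨h1, h3⟩, lt_of_lt_of_le (by positivity) h2⟩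
      · rintro ⟨⟨h1, h3⟩, h2⟩
        obtain ⟨n, hn⟩ := exists_nat_one_div_lt h2
        exact ⟨n, ⟨h1, hn.le⟩, h3⟩
    have heq : ρ (Ico a b) = ρ (Ico a b ∩ Ioi 0) := by
      have hnull : ρ (Ico a b \ Ioi 0) = 0 :=
        measure_mono_null (fun x hx => mem_Iic.2 (not_lt.1 fun h0 => hx.2 h0)) hρ
      rw [← measure_inter_add_sdiff (Ico a b) (measurableSet_Ioi (a := (0 : ℝ))), hnull, add_zero]
    rw [heq, ← hU]
    exact tendsto_measure_iUnion_atTop hmono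
  refine tendsto_nhds_unique (hcut ν hν0) ?_
  refine (hcut D hD0).congr fun n => (hpos _ _ (lt_max_of_lt_right (by positivity))).symm

/-- The density describes part of a probability law; the missing mass is the probability that no
station of this type exists. This bound yields all the integrability needed for the coverage
formula. -/
lemma IsModel.lintegral_lossDensity_le_one (h : net.IsModel μ) (j : LinkType) :
    ∫⁻ t in Ioi 0, ENNReal.ofReal (P.lossDensity j t) ≤ 1 := by
  have h1 := congrArg (fun ρ : Measure ℝ => ρ univ) (h.map_minLoss j)
  simp only [withDensity_apply _ MeasurableSet.univ, Measure.restrict_univ] at h1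
  rw [← h1, Measure.map_apply (h.measurable_minLoss j).ennreal_toReal MeasurableSet.univ]
  exact (measure_mono (subset_univ _)).trans (Measure.restrict_le_self univ |>.trans_eq measure_univ)

/-- The law of the path loss of the tagged BS, on the event that it has type `j`. -/
lemma IsModel.tsum_lintegral_isTagged (h : net.IsModel μ) (j : LinkType) {f : ℝ → ℝ≥0∞}
    (hf : Measurable f) :
    ∑' i, ∫⁻ ω, {ω | net.IsTagged ω (j, i)}.indicator (fun ω => f (net.pathLoss j i ω)) ω ∂μ =
      ∫⁻ l in Ioi 0, ENNReal.ofReal (P.lossDensity j l) *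
        (f l * ENNReal.ofReal (Real.exp (-(P.lamBS * P.M j.other l)))) := by
  classical
  have hmT : ∀ i, MeasurableSet {ω | net.IsTagged ω (j, i)} := fun i =>
    h.algebra_le univ _ (measurableSet_isTagged (fun _ => subset_univ _) _)
  have hne : MeasurableSet {x : ℝ≥0∞ | x ≠ ⊤} := (measurableSet_singleton ⊤).compl
  have hfm : ∀ i, Measurable fun ω => f (net.pathLoss j i ω) := fun i =>
    hf.comp (h.measurable_pathLoss j i)
  rw [← lintegral_tsum fun i => ((hfm i).indicator (hmT i)).aemeasurable]
  have hreg : ∫⁻ ω, ∑' i, {ω | net.IsTagged ω (j, i)}.indicator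
      (fun ω => f (net.pathLoss j i ω)) ω ∂μ =
      ∫⁻ ω, {x : ℝ≥0∞ | x ≠ ⊤}.indicator (fun x => f x.toReal) (net.minLoss j ω) *
        {p : ℝ≥0∞ × ℝ≥0∞ | p.1 ≤ p.2}.indicator (fun _ => 1)
          (net.minLoss j ω, net.minLoss j.other ω) ∂μ := by
    refine lintegral_congr_ae ?_
    filter_upwards [h.ae_isRegular] with ω hω
    rw [hω.tsum_isTagged j f]
    by_cases h1 : net.minLoss j ω = ⊤ <;>
      by_cases h2 : net.minLoss j ω ≤ net.minLoss j.other ω <;> simp [indicator, h1, h2]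
  have hgp : ∀ j, .process j ∈ geometry P j := fun j => Or.inl rfl
  have hgs : ∀ j i, .shadow j i ∈ geometry P j := fun j i => Or.inr ⟨i, rfl⟩
  have hF : Measurable ({x : ℝ≥0∞ | x ≠ ⊤}.indicator fun x => f x.toReal) :=
    (hf.comp ENNReal.measurable_toReal).indicator hne
  have hle : MeasurableSet {p : ℝ≥0∞ × ℝ≥0∞ | p.1 ≤ p.2} :=
    measurableSet_le measurable_fst measurable_snd
  have hT := fun j => measurable_algebra_minLoss (net := net) (hgp j) (hgs j)
  -- The two geometries are independent, so the smallest loss of the other type is integrated out;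
  -- what remains is its void probability at the current loss.
  have key := lintegral_mul_comp_of_indep (h.algebra_le _) (h.algebra_le _)
    (h.indep_algebra (disjoint_geometry j)) (hF.comp (hT j)) (hT j) (hT j.other)
    (measurable_const.indicator hle : Measurable
      ({p : ℝ≥0∞ × ℝ≥0∞ | p.1 ≤ p.2}.indicator fun _ => (1 : ℝ≥0∞)))
  rw [hreg]
  refine key.trans ?_
  have hmM : Measurable fun l => ENNReal.ofReal (Real.exp (-(P.lamBS * P.M j.other l))) :=
    ((P.measurable_M j.other).const_mul _).neg.exp.ennreal_ofReal
  have hinner : ∀ ω, net.IsRegular ω →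
      {x : ℝ≥0∞ | x ≠ ⊤}.indicator (fun x => f x.toReal) (net.minLoss j ω) *
        ∫⁻ s, {p : ℝ≥0∞ × ℝ≥0∞ | p.1 ≤ p.2}.indicator (fun _ => (1 : ℝ≥0∞)) (net.minLoss j ω, s)
          ∂μ.map (net.minLoss j.other) =
      {ω | net.minLoss j ω ≠ ⊤}.indicator (fun ω => f (net.minLoss j ω).toReal *
        ENNReal.ofReal (Real.exp (-(P.lamBS * P.M j.other (net.minLoss j ω).toReal)))) ω := by
    intro ω hω
    by_cases hj : net.minLoss j ω = ⊤
    · simp [indicator, hj]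
    obtain ⟨i, -, hi⟩ := hω.exists_pathLoss_eq hj
    have hl := pathLoss_pos (net := net) j i ω
    rw [indicator_of_mem (by exact hj), indicator_of_mem (by exact hj)]
    congr 1
    rw [hi, ENNReal.toReal_ofReal hl.le, ← h.measure_ofReal_le_minLoss j.other hl]
    have hms : MeasurableSet (Ici (ENNReal.ofReal (net.pathLoss j i ω))) := measurableSet_Ici
    change _ = μ (net.minLoss j.other ⁻¹' Ici (ENNReal.ofReal (net.pathLoss j i ω)))
    rw [← Measure.map_apply (h.measurable_minLoss j.other) hms, ← lintegral_indicator_one hms]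
    rfl
  have hms : MeasurableSet {ω | net.minLoss j ω ≠ ⊤} := h.measurable_minLoss j hne
  calc _ = ∫⁻ ω, {ω | net.minLoss j ω ≠ ⊤}.indicator (fun ω => f (net.minLoss j ω).toReal *
        ENNReal.ofReal (Real.exp (-(P.lamBS * P.M j.other (net.minLoss j ω).toReal)))) ω ∂μ :=
        lintegral_congr_ae (h.ae_isRegular.mono hinner)
    _ = ∫⁻ l, f l * ENNReal.ofReal (Real.exp (-(P.lamBS * P.M j.other l)))
        ∂((μ.restrict {ω | net.minLoss j ω ≠ ⊤}).map (fun ω => (net.minLoss j ω).toReal)) := by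
        rw [lintegral_indicator hms]
        exact (lintegral_map (hf.mul hmM) (h.measurable_minLoss j).ennreal_toReal).symm
    _ = _ := by
        rw [h.map_minLoss j]
        exact lintegral_withDensity_eq_lintegral_mul₀
          (P.aemeasurable_lossDensity j).ennreal_ofReal (hf.mul hmM).aemeasurable

end Network

/-! ### The coverage formula as a single integral -/

namespace Params

variable (P : Params) (j : LinkType)

lemma B_pos : 0 < P.B j := by
  cases j
  · have h1 := P.lamBS_pos
    have h2 := P.pLOS_pos
    have h3 := P.D_pos
    have h4 := Real.pi_pos
    simp only [B, sub_pos, Real.exp_lt_one_iff]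
    have : 0 < P.lamBS * Real.pi * P.pLOS * P.D ^ 2 := by positivity
    nlinarith
  · exact one_pos

lemma G_pos : 0 < P.G := by
  have h1 := P.power_pos
  have h2 : (0 : ℝ) < P.NBS := by exact_mod_cast P.NBS_pos
  have h3 : (0 : ℝ) < P.NUE := by exact_mod_cast P.NUE_pos
  unfold G
  positivity

lemma f_eq (t : ℝ) : P.f j t = P.lossDensity j t / P.B j := by
  rw [f, lossDensity, neg_mul]

/-- The rate at which the fading threshold grows with the path loss. -/
def gainRate (τ : ℝ) (U : ℕ) : ℝ := P.eta j * τ * U * P.noise / P.G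

lemma gainRate_nonneg {τ : ℝ} (hτ : 0 ≤ τ) (U : ℕ) : 0 ≤ P.gainRate j τ U := by
  have := P.G_pos
  have := P.noise_pos
  unfold gainRate
  positivity

lemma integrand_eq (τ : ℝ) (U n : ℕ) (l : ℝ) :
    P.integrand τ U j n l = Real.exp (-(n * (P.gainRate j τ U * l))) *
      Real.exp (-(P.lamBS * P.M j.other l)) * (P.lossDensity j l / P.B j) := by
  rw [integrand, f_eq, gainRate, ← Real.exp_add]
  congr 2
  ring

/-- Both exponentials are at most 1, so the density of the smallest loss dominates, up to the
constant factor 1 / `B j`. -/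
lemma integrableOn_integrand {τ : ℝ} (hτ : 0 ≤ τ) (U n : ℕ)
    (hint : IntegrableOn (P.lossDensity j) (Ioi 0)) :
    IntegrableOn (P.integrand τ U j n) (Ioi 0) := by
  have hM := P.measurable_M j.other
  rw [show P.integrand τ U j n = fun l => Real.exp (-(n * (P.gainRate j τ U * l))) *
      Real.exp (-(P.lamBS * P.M j.other l)) * (P.lossDensity j l / P.B j) from
    funext fun l => P.integrand_eq j τ U n l]
  refine Integrable.bdd_mul (c := 1) (hint.div_const _) ?_ ?_
  · exact (Measurable.mul (by fun_prop) (hM.const_mul _).neg.exp).aestronglyMeasurable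
  · filter_upwards [ae_restrict_mem measurableSet_Ioi] with l hl
    have h1 : 0 ≤ n * (P.gainRate j τ U * l) :=
      mul_nonneg (Nat.cast_nonneg _) (mul_nonneg (P.gainRate_nonneg j hτ U) (le_of_lt hl))
    have h2 := P.lamBS_mul_M_nonneg j.other hl
    rw [Real.norm_of_nonneg (by positivity)]
    exact mul_le_one₀ (Real.exp_le_one_iff.2 (by linarith)) (Real.exp_pos _).le
      (Real.exp_le_one_iff.2 (by linarith))

/-- The summand of the coverage formula, without the zero-forcing penalty. -/
def fadingTerm (τ : ℝ) (U : ℕ) : ℝ :=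
  P.B j * ∑ n ∈ Finset.Icc 1 (P.eta j), (-1) ^ (n + 1) * ((P.eta j).choose n : ℝ) *
      ∫ l in Ioi (0 : ℝ), P.integrand τ U j n l

lemma coverageTerm_eq (τ : ℝ) (U : ℕ) :
    P.coverageTerm τ U j = P.zeta (P.eta j) U * P.fadingTerm j τ U := by
  rw [coverageTerm, fadingTerm]
  ring

/-- The prefactor `B j` undoes the normalization of `f`, so the sum of integrals collapses to the
unnormalized density times the fading tail. -/
lemma lossDensity_mul_gain (τ : ℝ) (U : ℕ) (l : ℝ) :
    P.lossDensity j l * ((1 - (1 - Real.exp (-(P.gainRate j τ U * l))) ^ P.eta j) *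
        Real.exp (-(P.lamBS * P.M j.other l))) =
      P.B j * ∑ n ∈ Finset.Icc 1 (P.eta j), (-1) ^ (n + 1) * ((P.eta j).choose n : ℝ) *
        P.integrand τ U j n l := by
  rw [one_sub_one_sub_exp_pow, Finset.sum_mul, Finset.mul_sum, Finset.mul_sum]
  refine Finset.sum_congr rfl fun n _ => ?_
  rw [integrand_eq]
  have := (P.B_pos j).ne'
  field_simp

lemma gain_nonneg {c : ℝ} (hc : 0 ≤ c) (n : ℕ) : 0 ≤ 1 - (1 - Real.exp (-c)) ^ n :=
  sub_nonneg.2 (pow_le_one₀ (sub_nonneg.2 (Real.exp_le_one_iff.2 (by linarith)))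
    (sub_le_self _ (Real.exp_pos _).le))

lemma fadingTerm_eq {τ : ℝ} (hτ : 0 ≤ τ) (U : ℕ)
    (hint : IntegrableOn (P.lossDensity j) (Ioi 0)) :
    P.fadingTerm j τ U = ∫ l in Ioi 0, P.lossDensity j l *
      ((1 - (1 - Real.exp (-(P.gainRate j τ U * l))) ^ P.eta j) *
        Real.exp (-(P.lamBS * P.M j.other l))) := by
  simp_rw [lossDensity_mul_gain]
  rw [integral_const_mul, integral_finsetSum _ fun n _ =>
    (P.integrableOn_integrand j hτ U n hint).const_mul _, fadingTerm]
  simp_rw [integral_const_mul]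

lemma lossDensity_mul_gain_nonneg {τ : ℝ} (hτ : 0 ≤ τ) (U : ℕ) {l : ℝ} (hl : 0 < l) :
    0 ≤ P.lossDensity j l * ((1 - (1 - Real.exp (-(P.gainRate j τ U * l))) ^ P.eta j) *
        Real.exp (-(P.lamBS * P.M j.other l))) :=
  mul_nonneg (P.lossDensity_nonneg j hl) (mul_nonneg
    (gain_nonneg (mul_nonneg (P.gainRate_nonneg j hτ U) hl.le) _) (Real.exp_pos _).le)

/-- Visible only after the alternating sum has been recombined into a fading probability. -/
lemma fadingTerm_nonneg {τ : ℝ} (hτ : 0 ≤ τ) (U : ℕ)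
    (hint : IntegrableOn (P.lossDensity j) (Ioi 0)) : 0 ≤ P.fadingTerm j τ U := by
  rw [P.fadingTerm_eq j hτ U hint]
  exact setIntegral_nonneg measurableSet_Ioi fun l hl => P.lossDensity_mul_gain_nonneg j hτ U hl

lemma ofReal_fadingTerm {τ : ℝ} (hτ : 0 ≤ τ) (U : ℕ)
    (hint : IntegrableOn (P.lossDensity j) (Ioi 0)) :
    ENNReal.ofReal (P.fadingTerm j τ U) = ∫⁻ l in Ioi 0, ENNReal.ofReal (P.lossDensity j l) *
      (ENNReal.ofReal (1 - (1 - Real.exp (-(P.gainRate j τ U * l))) ^ P.eta j) *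
        ENNReal.ofReal (Real.exp (-(P.lamBS * P.M j.other l)))) := by
  have hi : IntegrableOn (fun l => P.lossDensity j l *
      ((1 - (1 - Real.exp (-(P.gainRate j τ U * l))) ^ P.eta j) *
        Real.exp (-(P.lamBS * P.M j.other l)))) (Ioi 0) := by
    simp_rw [lossDensity_mul_gain]
    exact (integrable_finsetSum _ fun n _ =>
      (P.integrableOn_integrand j hτ U n hint).const_mul _).const_mul _
  rw [P.fadingTerm_eq j hτ U hint, ofReal_integral_eq_lintegral_ofReal hi
    ((ae_restrict_iff' measurableSet_Ioi).2 (ae_of_all _ fun l hl =>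
      P.lossDensity_mul_gain_nonneg j hτ U hl))]
  refine setLIntegral_congr_fun measurableSet_Ioi fun l hl => ?_
  have h1 := gain_nonneg (mul_nonneg (P.gainRate_nonneg j hτ U) (le_of_lt hl)) (P.eta j)
  rw [ENNReal.ofReal_mul (P.lossDensity_nonneg j hl), ENNReal.ofReal_mul h1]

/-! ### Load -/

lemma rho_pos : 0 < P.rho := div_pos P.lamUE_pos P.lamBS_pos

lemma kappa_zero : P.kappa 0 = 0 := if_pos rfl

lemma kappa_pos {n : ℕ} (hn : n ≠ 0) : 0 < P.kappa n := by
  have h1 := P.rho_pos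
  have h2 : 0 < Real.Gamma ((n : ℝ) + 3.5) := Real.Gamma_pos_of_pos (by positivity)
  have h3 : 0 < Real.Gamma 3.5 := Real.Gamma_pos_of_pos (by norm_num)
  rw [kappa, if_neg hn]
  positivity

lemma kappa_nonneg (n : ℕ) : 0 ≤ P.kappa n := by
  rcases eq_or_ne n 0 with rfl | hn
  exacts [P.kappa_zero.ge, (P.kappa_pos hn).le]

end Params

lemma tsum_linkType (f : LinkType → ℝ≥0∞) : ∑' j, f j = f .LOS + f .NLOS := by
  let e : Bool ≃ LinkType :=
    { toFun := fun b => if b then .NLOS else .LOS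
      invFun := fun j => match j with
        | .LOS => false
        | .NLOS => true
      left_inv := by rintro (_ | _) <;> rfl
      right_inv := by rintro (_ | _) <;> rfl }
  rw [← e.tsum_eq, tsum_bool]
  rfl

/-! ### Fading, penalty and load at the serving station -/

namespace Network

variable {P : Params} {Ω : Type*} {net : Network P Ω}

lemma measurable_algebra_maxGain {S : Set (Source P)} {j : LinkType} {i : ℕ}
    (h : ∀ k, .fading j i k ∈ S) : Measurable[net.algebra S] (net.maxGain j i) :=
  Measurable.iSup fun k => (measurable_norm.pow_const 2).comp (measurable_algebra_fading (h k))

lemma measurable_algebra_streams {S : Set (Source P)} (h : .load ∈ S) :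
    Measurable[net.algebra S] net.streams :=
  (Measurable.of_discrete (f := fun n : ℕ => min P.UM n)).comp (measurable_algebra_load h)

variable [MeasurableSpace Ω] {μ : Measure Ω}

lemma IsModel.measurable_streams (h : net.IsModel μ) : Measurable net.streams :=
  (measurable_algebra_streams (mem_univ _)).mono (h.algebra_le univ) le_rfl

lemma IsModel.measurable_maxGain (h : net.IsModel μ) (j : LinkType) (i : ℕ) :
    Measurable (net.maxGain j i) :=
  (measurable_algebra_maxGain fun _ => mem_univ _).mono (h.algebra_le univ) le_rfl

lemma IsModel.measurableSet_isTagged (h : net.IsModel μ) (b : LinkType × ℕ) :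
    MeasurableSet {ω | net.IsTagged ω b} :=
  h.algebra_le univ _ (Network.measurableSet_isTagged (fun _ => subset_univ _) _)

lemma IsModel.measureReal_load (h : net.IsModel μ) (n : ℕ) :
    μ.real {ω | net.load ω = n} = P.kappa n := by
  rw [measureReal_def, h.load_pmf, ENNReal.toReal_ofReal (P.kappa_nonneg n)]

/-- Every load n ≥ 1 has positive probability, and a load `U ≤ U_M` gives exactly `U` streams. Hence
the conditioning is on a non-null event. -/
lemma IsModel.measure_streams_ne_zero (h : net.IsModel μ) {U : ℕ} (hU : U ∈ Finset.Icc 1 P.UM) :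
    μ {ω | net.streams ω = U} ≠ 0 := by
  rw [Finset.mem_Icc] at hU
  have h1 : μ {ω | net.load ω = U} ≠ 0 := by
    rw [h.load_pmf]
    simpa using P.kappa_pos (by omega)
  refine fun h0 => h1 (measure_mono_null (fun ω (hω : net.load ω = U) => ?_) h0)
  change min P.UM (net.load ω) = U
  omega

variable [IsProbabilityMeasure μ]

lemma IsModel.integrableOn_lossDensity (h : net.IsModel μ) (j : LinkType) :
    IntegrableOn (P.lossDensity j) (Ioi 0) := by
  refine ⟨(P.aemeasurable_lossDensity j).aestronglyMeasurable, ?_⟩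
  rw [hasFiniteIntegral_iff_ofReal ((ae_restrict_iff' measurableSet_Ioi).2 (ae_of_all _ fun l hl =>
    P.lossDensity_nonneg j hl))]
  exact (h.lintegral_lossDensity_le_one j).trans_lt ENNReal.one_lt_top

/-! ### Fading on the tagged link -/

lemma IsModel.measure_maxGain_gt (h : net.IsModel μ) (j : LinkType) (i : ℕ) {c : ℝ} (hc : 0 ≤ c) :
    μ {ω | c < net.maxGain j i ω} = ENNReal.ofReal (1 - (1 - Real.exp (-c)) ^ P.eta j) := by
  have hind : iIndepFun (fun k => net.fading j i k) μ := by
    rw [iIndepFun_iff_iIndep]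
    exact h.indep.precomp (g := fun k => Source.fading j i k) fun k k' hk => by
      injection hk
  exact measure_iSup_normSq_gt (P.eta_pos j) (h.measurable_fading j i) hind (h.map_fading j i) hc

/-- The fading on a link is independent of all locations and shadowings, hence of which station is
tagged. Integrating it out leaves a function of the tagged loss. -/
lemma IsModel.tsum_measure_isTagged_gain (h : net.IsModel μ) (j : LinkType) {c : ℝ} (hc : 0 ≤ c) :
    ∑' i, μ {ω | net.IsTagged ω (j, i) ∧ c * net.pathLoss j i ω < net.maxGain j i ω} =
      ∫⁻ l in Ioi 0, ENNReal.ofReal (P.lossDensity j l) *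
        (ENNReal.ofReal (1 - (1 - Real.exp (-(c * l))) ^ P.eta j) *
          ENNReal.ofReal (Real.exp (-(P.lamBS * P.M j.other l)))) := by
  rw [← h.tsum_lintegral_isTagged j (f := fun l =>
    ENNReal.ofReal (1 - (1 - Real.exp (-(c * l))) ^ P.eta j)) (by fun_prop)]
  refine tsum_congr fun i => ?_
  set S : Set (Source P) := {s | ∃ j, s ∈ geometry P j} with hS
  set T : Set (Source P) := Set.range fun k => Source.fading j i k with hT
  have hdisj : Disjoint S T := by
    rw [Set.disjoint_left]
    rintro s ⟨j', rfl | ⟨i', rfl⟩⟩ ⟨k, hk⟩ <;> cases hk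
  have hSj : ∀ j, geometry P j ⊆ S := fun j s hs => ⟨j, hs⟩
  have hlt : MeasurableSet {p : ℝ × ℝ | c * p.1 < p.2} :=
    measurableSet_lt (measurable_fst.const_mul c) measurable_snd
  have key := lintegral_mul_comp_of_indep (h.algebra_le _) (h.algebra_le _) (h.indep_algebra hdisj)
    (A := {ω | net.IsTagged ω (j, i)}.indicator fun _ => 1)
    (measurable_const.indicator (Network.measurableSet_isTagged hSj _))
    (measurable_algebra_pathLoss (i := i) (hSj j (Or.inl rfl)) (hSj j (Or.inr ⟨i, rfl⟩)))
    (measurable_algebra_maxGain (j := j) (i := i) fun k => mem_range_self k)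
    (φ := {p : ℝ × ℝ | c * p.1 < p.2}.indicator fun _ => 1) (measurable_const.indicator hlt)
  have hms : MeasurableSet {ω | net.IsTagged ω (j, i) ∧ c * net.pathLoss j i ω < net.maxGain j i ω} :=
    (h.measurableSet_isTagged _).inter
      (measurableSet_lt ((h.measurable_pathLoss j i).const_mul c) (h.measurable_maxGain j i))
  rw [← lintegral_indicator_one hms]
  refine Eq.trans (lintegral_congr fun ω => ?_) (key.trans (lintegral_congr fun ω => ?_))
  · by_cases h1 : net.IsTagged ω (j, i) <;> simp [indicator, h1]
  · by_cases h1 : net.IsTagged ω (j, i)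
    · rw [indicator_of_mem (by exact h1), indicator_of_mem (by exact h1), one_mul,
        ← h.measure_maxGain_gt j i (mul_nonneg hc (pathLoss_pos j i ω).le)]
      have hm : MeasurableSet (Ioi (c * net.pathLoss j i ω)) := measurableSet_Ioi
      change _ = μ (net.maxGain j i ⁻¹' Ioi (c * net.pathLoss j i ω))
      rw [← Measure.map_apply (h.measurable_maxGain j i) hm, ← lintegral_indicator_one hm]
      rfl
    · rw [indicator_of_notMem (by exact h1), indicator_of_notMem (by exact h1), zero_mul]

lemma IsModel.tsum_measure_isTagged_gainRate (h : net.IsModel μ) (j : LinkType) {τ : ℝ} (hτ : 0 ≤ τ)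
    (U : ℕ) :
    ∑' i, μ {ω | net.IsTagged ω (j, i) ∧
        P.gainRate j τ U * net.pathLoss j i ω < net.maxGain j i ω} =
      ENNReal.ofReal (P.fadingTerm j τ U) := by
  rw [P.ofReal_fadingTerm j hτ U (h.integrableOn_lossDensity j),
    h.tsum_measure_isTagged_gain j (P.gainRate_nonneg j hτ U)]

/-! ### Zero-forcing penalty -/

/-- The SNR on the link to the BS `(j, i)` if it sends `U` streams. -/
def linkSNR (net : Network P Ω) (U : ℕ) (j : LinkType) (i : ℕ) (ω : Ω) : ℝ :=
  P.G / (P.eta j * U * P.noise) * net.maxGain j i ω * (net.pathLoss j i ω)⁻¹ * net.penalty j U ω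

omit [MeasurableSpace Ω] in
lemma IsRegular.snr_eq {ω : Ω} (h : net.IsRegular ω) {b : LinkType × ℕ} (hb : net.IsTagged ω b) :
    net.snr ω = net.linkSNR (net.streams ω) b.1 b.2 ω := by
  have htag : net.tagged ω = b := h.tagged_unique (Classical.epsilon_spec ⟨b, hb⟩) hb
  rw [← htag]
  rfl

omit [MeasurableSpace Ω] in
lemma lt_linkSNR_iff {τ : ℝ} {U : ℕ} (hU : 1 ≤ U) (j : LinkType) (i : ℕ) (ω : Ω) :
    τ < P.G / (P.eta j * U * P.noise) * net.maxGain j i ω * (net.pathLoss j i ω)⁻¹ ↔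
      P.gainRate j τ U * net.pathLoss j i ω < net.maxGain j i ω := by
  have h1 : (0 : ℝ) < U := by exact_mod_cast hU
  have h2 : (0 : ℝ) < P.eta j := by exact_mod_cast P.eta_pos j
  have h3 := P.noise_pos
  have h4 := P.G_pos
  have h5 := pathLoss_pos (net := net) j i ω
  rw [Params.gainRate, ← div_eq_mul_inv, lt_div_iff₀ h5, div_mul_eq_mul_div (P.eta j * τ * U * P.noise),
    div_lt_iff₀ h4, div_mul_eq_mul_div, lt_div_iff₀ (by positivity)]
  constructor <;> intro h <;> linarith

omit [IsProbabilityMeasure μ] in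
lemma IsModel.measure_gain_inter_penalty (h : net.IsModel μ) (j : LinkType) (i : ℕ) (c : ℝ) (U : ℕ)
    {A : Set ℝ} (hA : MeasurableSet A) :
    μ ({ω | net.IsTagged ω (j, i) ∧ c * net.pathLoss j i ω < net.maxGain j i ω} ∩
        net.penalty j U ⁻¹' A) =
      μ {ω | net.IsTagged ω (j, i) ∧ c * net.pathLoss j i ω < net.maxGain j i ω} *
        μ.map (net.penalty j U) A := by
  have hdisj : Disjoint ({.penalty}ᶜ : Set (Source P)) {.penalty} := disjoint_compl_left
  rw [Measure.map_apply (h.measurable_penalty j U) hA]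
  have hloss : Measurable[net.algebra {.penalty}ᶜ] (net.pathLoss j i) :=
    measurable_algebra_pathLoss (by simp) (by simp)
  have hgain : Measurable[net.algebra {.penalty}ᶜ] (net.maxGain j i) :=
    measurable_algebra_maxGain (by simp)
  have htag : MeasurableSet[net.algebra {.penalty}ᶜ] {ω | net.IsTagged ω (j, i)} :=
    Network.measurableSet_isTagged (fun j' s hs => by rcases hs with rfl | ⟨i', rfl⟩ <;> simp) _
  have hlt : MeasurableSet[net.algebra {.penalty}ᶜ]
      {ω | c * net.pathLoss j i ω < net.maxGain j i ω} :=
    measurableSet_lt (hloss.const_mul c) hgain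
  have hpen : MeasurableSet[net.algebra {.penalty}] (net.penalty j U ⁻¹' A) :=
    measurable_algebra_penalty (mem_singleton _) U hA
  exact (Indep_iff _ _ μ).1 (h.indep_algebra hdisj) _ _ (htag.inter hlt) hpen

/-- For p < 0, truncation by `ENNReal.ofReal` would leave total mass 1 - p > 1. Nonnegativity of ζ
is thus obtained from the penalty hypothesis rather than from the formula for ζ. -/
lemma nonneg_of_isProbabilityMeasure_bernoulliLaw {p : ℝ} (h : IsProbabilityMeasure (bernoulliLaw p)) : 0 ≤ p := by
  by_contra! hp
  have h1 := h.measure_univ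
  simp only [bernoulliLaw, Measure.add_apply, Measure.smul_apply, measure_univ, smul_eq_mul,
    mul_one, ENNReal.ofReal_of_nonpos hp.le, zero_add] at h1
  have h2 := ENNReal.ofReal_eq_one.1 h1
  linarith

lemma bernoulliLaw_singleton_one (p : ℝ) : bernoulliLaw p {1} = ENNReal.ofReal p := by
  simp [bernoulliLaw]

lemma bernoulliLaw_compl (p : ℝ) : bernoulliLaw p {0, 1}ᶜ = 0 := by
  simp [bernoulliLaw]

/-- Domination is tested at levels increasing to 1 from below, each exceeded by the atom of the
Bernoulli law at 1; continuity from above gives the closed half-line. -/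
lemma ofReal_le_of_stochDominates {ν : Measure ℝ} [IsFiniteMeasure ν] {p : ℝ}
    (h : StochDominates ν (bernoulliLaw p)) : ENNReal.ofReal p ≤ ν (Ici 1) := by
  have hI : (⋂ n : ℕ, Ioi (1 - 1 / ((n : ℝ) + 1))) = Ici 1 := by
    ext x
    simp only [mem_iInter, mem_Ioi, mem_Ici]
    refine ⟨fun H => ?_, fun hx n => lt_of_lt_of_le (sub_lt_self _ (by positivity)) hx⟩
    by_contra! hx
    obtain ⟨n, hn⟩ := exists_nat_one_div_lt (sub_pos.2 hx)
    linarith [H n]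
  have ht : Tendsto (fun n : ℕ => ν (Ioi (1 - 1 / ((n : ℝ) + 1)))) atTop (𝓝 (ν (Ici 1))) := by
    rw [← hI]
    refine tendsto_measure_iInter_atTop (fun _ => measurableSet_Ioi.nullMeasurableSet)
      (fun n m hnm => Ioi_subset_Ioi (sub_le_sub_left (one_div_le_one_div_of_le (by positivity)
        (by exact_mod_cast Nat.succ_le_succ hnm)) _)) ⟨0, measure_ne_top _ _⟩
  refine ge_of_tendsto' ht fun n => le_trans ?_ (h _)
  rw [← bernoulliLaw_singleton_one p]
  exact measure_mono (singleton_subset_iff.2 (sub_lt_self (1 : ℝ) (by positivity)))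

/-- Since τ ≥ 0, a zero penalty never gives coverage. The event is therefore a large fading gain
together with penalty 1, and independence yields the factor ζ. -/
lemma IsModel.tsum_measure_linkSNR_of_bernoulli (h : net.IsModel μ) {τ : ℝ} (hτ : 0 ≤ τ) {U : ℕ}
    (hU : 1 ≤ U) (hpen : net.PenaltyIsBernoulli μ U) (j : LinkType) :
    ∑' i, μ {ω | net.IsTagged ω (j, i) ∧ τ < net.linkSNR U j i ω} =
      ENNReal.ofReal (P.coverageTerm τ U j) := by
  have hpm : IsProbabilityMeasure (bernoulliLaw (P.zeta (P.eta j) U)) := by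
    rw [← hpen j]
    exact Measure.isProbabilityMeasure_map (h.measurable_penalty j U).aemeasurable
  rw [P.coverageTerm_eq, ENNReal.ofReal_mul (nonneg_of_isProbabilityMeasure_bernoulliLaw hpm),
    ← h.tsum_measure_isTagged_gainRate j hτ U, mul_comm, ← ENNReal.tsum_mul_right]
  refine tsum_congr fun i => ?_
  rw [← bernoulliLaw_singleton_one, ← hpen j,
    ← h.measure_gain_inter_penalty j i _ U (measurableSet_singleton 1)]
  refine measure_congr ?_
  have h01 : ∀ᵐ ω ∂μ, net.penalty j U ω = 0 ∨ net.penalty j U ω = 1 := by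
    have : ∀ᵐ x ∂μ.map (net.penalty j U), x = 0 ∨ x = 1 := by
      rw [hpen j]
      exact bernoulliLaw_compl _
    exact ae_of_ae_map (h.measurable_penalty j U).aemeasurable this
  filter_upwards [h01] with ω hω
  refine propext ?_
  change net.IsTagged ω (j, i) ∧ τ < net.linkSNR U j i ω ↔ (net.IsTagged ω (j, i) ∧
    P.gainRate j τ U * net.pathLoss j i ω < net.maxGain j i ω) ∧ net.penalty j U ω = 1
  rw [← lt_linkSNR_iff hU, linkSNR]
  rcases hω with hω | hω
  · simp [hω, hτ.not_gt]
  · simp [hω]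

lemma IsModel.le_tsum_measure_linkSNR_of_dominates (h : net.IsModel μ) {τ : ℝ} (hτ : 0 ≤ τ) {U : ℕ}
    (hU : 1 ≤ U) (hpen : net.PenaltyDominates μ U) (j : LinkType) :
    ENNReal.ofReal (P.coverageTerm τ U j) ≤
      ∑' i, μ {ω | net.IsTagged ω (j, i) ∧ τ < net.linkSNR U j i ω} := by
  have hpm : IsProbabilityMeasure (μ.map (net.penalty j U)) :=
    Measure.isProbabilityMeasure_map (h.measurable_penalty j U).aemeasurable
  -- The product is split along the fading term, whose sign is known; here nothing is known about
  -- the sign of ζ.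
  rw [P.coverageTerm_eq, mul_comm, ENNReal.ofReal_mul
    (P.fadingTerm_nonneg j hτ U (h.integrableOn_lossDensity j)),
    ← h.tsum_measure_isTagged_gainRate j hτ U, ← ENNReal.tsum_mul_right]
  refine ENNReal.tsum_le_tsum fun i => ?_
  refine (mul_le_mul_right (ofReal_le_of_stochDominates (hpen j)) _).trans ?_
  rw [← h.measure_gain_inter_penalty j i _ U measurableSet_Ici]
  refine measure_mono ?_
  rintro ω ⟨⟨h1, h2⟩, h3⟩
  refine ⟨h1, ?_⟩
  rw [← lt_linkSNR_iff hU] at h2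
  -- The SNR without penalty exceeds τ ≥ 0, so a penalty of at least 1 cannot decrease it.
  refine h2.trans_le ?_
  rw [linkSNR]
  exact le_mul_of_one_le_right (hτ.trans h2.le) h3

/-! ### Streams -/

lemma IsModel.measureReal_streams (h : net.IsModel μ) (U : ℕ) :
    μ.real {ω | net.streams ω = U} = P.streamPMF U := by
  rcases lt_trichotomy U P.UM with hU | rfl | hU
  · rw [Params.streamPMF, if_pos hU, if_neg hU.ne, add_zero, ← h.measureReal_load]
    congr 1
    ext ω
    simp only [mem_ofPred_eq, streams]
    omega
  · rw [Params.streamPMF, if_neg (lt_irrefl _), if_pos rfl, zero_add]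
    have hset : {ω | net.streams ω = P.UM} =
        (⋃ i ∈ Finset.range P.UM, {ω | net.load ω = i})ᶜ := by
      ext ω
      simp only [streams, mem_ofPred_eq, mem_compl_iff, mem_iUnion, Finset.mem_range, exists_prop,
        not_exists, not_and]
      exact ⟨fun hω i hi => by omega, fun hω => by have := hω (net.load ω); omega⟩
    have hm : ∀ i, MeasurableSet {ω | net.load ω = i} := fun i =>
      h.measurable_load (measurableSet_singleton i)
    rw [hset, probReal_compl_eq_one_sub (Finset.measurableSet_biUnion _ fun i _ => hm i),
      measureReal_biUnion_finset (fun i _ k _ hik => Set.disjoint_left.2 fun ω hi hk =>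
        hik (hi.symm.trans hk)) fun i _ => hm i]
    simp_rw [h.measureReal_load]
    congr 1
    -- The range starts at load 0, the interval at 1; the extra term is κ(0) = 0.
    refine (Finset.sum_subset (fun i hi => ?_) fun i hi hi' => ?_).symm
    · simp only [Finset.mem_Icc, Finset.mem_range] at hi ⊢
      omega
    · have : i = 0 := by
        simp only [Finset.mem_Icc, Finset.mem_range] at hi hi'
        omega
      rw [this, P.kappa_zero]
  · rw [Params.streamPMF, if_neg hU.not_gt, if_neg hU.ne', add_zero,
      show {ω | net.streams ω = U} = ∅ from eq_empty_of_forall_notMem fun ω hω => by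
        simp only [mem_ofPred_eq, streams] at hω
        omega, measureReal_empty]

omit [IsProbabilityMeasure μ] in
lemma IsModel.ae_streams_mem (h : net.IsModel μ) :
    ∀ᵐ ω ∂μ, net.streams ω ∈ Finset.Icc 1 P.UM := by
  have h0 : μ {ω | net.load ω = 0} = 0 := by
    rw [h.load_pmf, P.kappa_zero, ENNReal.ofReal_zero]
  filter_upwards [measure_eq_zero_iff_ae_notMem.1 h0] with ω hω
  have := P.UM_pos
  have : net.load ω ≠ 0 := hω
  rw [Finset.mem_Icc, streams]
  omega

lemma IsModel.integral_streams (h : net.IsModel μ) (f : ℕ → ℝ) :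
    ∫ ω, f (net.streams ω) ∂μ = ∑ U ∈ Finset.Icc 1 P.UM, P.streamPMF U * f U := by
  have hm : ∀ U, MeasurableSet {ω | net.streams ω = U} := fun U =>
    h.measurable_streams (measurableSet_singleton U)
  have hae : ∀ᵐ ω ∂μ, f (net.streams ω) =
      ∑ U ∈ Finset.Icc 1 P.UM, {ω | net.streams ω = U}.indicator (fun _ => f U) ω := by
    filter_upwards [h.ae_streams_mem] with ω hω
    rw [Finset.sum_eq_single_of_mem _ hω fun U _ hU => indicator_of_notMem (fun hmem => hU ?_) _,
      indicator_of_mem (by exact rfl)]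
    exact (show net.streams ω = U from hmem).symm
  rw [integral_congr_ae hae, integral_finsetSum _ fun U _ =>
    (integrable_const _).indicator (hm U)]
  refine Finset.sum_congr rfl fun U _ => ?_
  rw [integral_indicator_const _ (hm U), h.measureReal_streams, smul_eq_mul]

/-- Total probability, phrased through `μ.restrict A` so that only the stream events have to be
measurable. The SNR involves a choice of the tagged station, and its measurability is never
required. -/
lemma IsModel.measureReal_eq_sum_streams (h : net.IsModel μ) (A : Set Ω) :
    μ.real A = ∑ U ∈ Finset.Icc 1 P.UM,
      P.streamPMF U * (ProbabilityTheory.cond μ {ω | net.streams ω = U}).real A := by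
  have hm : ∀ U, MeasurableSet {ω | net.streams ω = U} := fun U =>
    h.measurable_streams (measurableSet_singleton U)
  have hU : ∀ U ∈ Finset.Icc 1 P.UM,
      P.streamPMF U * (ProbabilityTheory.cond μ {ω | net.streams ω = U}).real A =
        (μ.restrict A).real {ω | net.streams ω = U} := by
    intro U hU
    have h0 := h.measure_streams_ne_zero hU
    rw [measureReal_def, cond_apply (hm U), measureReal_def, Measure.restrict_apply (hm U),
      ENNReal.toReal_mul, ENNReal.toReal_inv, ← measureReal_def, ← h.measureReal_streams,
      mul_inv_cancel_left₀]
    rw [measureReal_def]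
    exact ENNReal.toReal_ne_zero.2 ⟨h0, measure_ne_top _ _⟩
  rw [Finset.sum_congr rfl hU, ← measureReal_biUnion_finset (fun i _ k _ hik =>
    Set.disjoint_left.2 fun ω hi hk => hik (hi.symm.trans hk)) fun i _ => hm i,
    ← measureReal_restrict_apply_univ]
  refine measureReal_congr ?_
  filter_upwards [ae_restrict_of_ae h.ae_streams_mem] with ω hω
  refine propext ⟨fun _ => mem_iUnion₂.2 ⟨_, hω, rfl⟩, fun _ => trivial⟩

omit [MeasurableSpace Ω] in
lemma measurableSet_isTagged_linkSNR (τ : ℝ) (U : ℕ) (b : LinkType × ℕ) :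
    MeasurableSet[net.algebra {.load}ᶜ]
      {ω | net.IsTagged ω b ∧ τ < net.linkSNR U b.1 b.2 ω} := by
  obtain ⟨j, i⟩ := b
  have hloss : Measurable[net.algebra {.load}ᶜ] (net.pathLoss j i) :=
    measurable_algebra_pathLoss (by simp) (by simp)
  have hgain : Measurable[net.algebra {.load}ᶜ] (net.maxGain j i) :=
    measurable_algebra_maxGain (by simp)
  have hpen : Measurable[net.algebra {.load}ᶜ] (net.penalty j U) :=
    measurable_algebra_penalty (by simp) U
  have htag : MeasurableSet[net.algebra {.load}ᶜ] {ω | net.IsTagged ω (j, i)} :=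
    Network.measurableSet_isTagged (fun j' s hs => by rcases hs with rfl | ⟨i', rfl⟩ <;> simp) _
  have hsnr : Measurable[net.algebra {.load}ᶜ] (net.linkSNR U j i) :=
    ((hgain.const_mul _).mul hloss.inv).mul hpen
  exact htag.inter (measurableSet_lt measurable_const hsnr)

/-- The conditional coverage is the sum over the BSs of the coverage when they are tagged. -/
lemma IsModel.cond_streams (h : net.IsModel μ) (τ : ℝ) {U : ℕ} (hU : U ∈ Finset.Icc 1 P.UM) :
    ProbabilityTheory.cond μ {ω | net.streams ω = U} {ω | τ < net.snr ω} =
      ∑' i, μ {ω | net.IsTagged ω (.LOS, i) ∧ τ < net.linkSNR U .LOS i ω} +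
      ∑' i, μ {ω | net.IsTagged ω (.NLOS, i) ∧ τ < net.linkSNR U .NLOS i ω} := by
  have := countable_linkType
  have hm : MeasurableSet {ω | net.streams ω = U} :=
    h.measurable_streams (measurableSet_singleton U)
  set W : LinkType × ℕ → Set Ω := fun b =>
    {ω | net.IsTagged ω b ∧ τ < net.linkSNR U b.1 b.2 ω} with hW
  have hWm : ∀ b, MeasurableSet[net.algebra {.load}ᶜ] (W b) := fun b =>
    measurableSet_isTagged_linkSNR τ U b
  have hload : MeasurableSet[net.algebra {.load}] {ω | net.streams ω = U} :=
    measurable_algebra_streams (mem_singleton _) (measurableSet_singleton U)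
  have hdisj : Disjoint ({.load} : Set (Source P)) {.load}ᶜ := disjoint_compl_right
  have hind : ∀ b, μ ({ω | net.streams ω = U} ∩ W b) = μ {ω | net.streams ω = U} * μ (W b) :=
    fun b => (Indep_iff _ _ μ).1 (h.indep_algebra hdisj) _ _ hload (hWm b)
  -- On regular outcomes the unknown serving station is replaced by a union over all candidates,
  -- which are disjoint up to a null set. Independence of the load then cancels the probability of
  -- the conditioning event.
  have hunion : ({ω | net.streams ω = U} ∩ {ω | τ < net.snr ω} : Set Ω) =ᵐ[μ]
      ⋃ b, {ω | net.streams ω = U} ∩ W b := by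
    refine eventuallyEq_set.2 ?_
    filter_upwards [h.ae_isRegular] with ω hω
    obtain ⟨b, hb, -⟩ := hω.existsUnique_isTagged
    have hsnr := hω.snr_eq hb
    refine ⟨fun hω' => mem_iUnion.2 ⟨b, hω'.1, hb, ?_⟩, fun hω' => ?_⟩
    · have h1 : τ < net.snr ω := hω'.2
      rwa [hsnr, hω'.1] at h1
    · obtain ⟨b', hs, hb', hlt⟩ := mem_iUnion.1 hω'
      obtain rfl := hω.tagged_unique hb hb'
      refine ⟨hs, ?_⟩
      change τ < net.snr ω
      rwa [hsnr, show net.streams ω = U from hs]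
  rw [cond_apply hm, measure_congr hunion, measure_iUnion₀]
  · simp_rw [hind]
    rw [ENNReal.tsum_mul_left, ← mul_assoc, ENNReal.inv_mul_cancel (h.measure_streams_ne_zero hU)
      (measure_ne_top _ _), one_mul, ENNReal.tsum_prod', tsum_linkType]
  · intro b b' hbb
    refine measure_mono_null ?_ (ae_iff.1 h.ae_isRegular)
    rintro ω ⟨h1, h2⟩ hω
    exact hbb (hω.tagged_unique h1.2.1 h2.2.1)
  · exact fun b => (hm.inter (h.algebra_le _ _ (hWm b))).nullMeasurableSet

lemma IsModel.condCoverage_eq_of_bernoulli (h : net.IsModel μ) {τ : ℝ} (hτ : 0 ≤ τ) {U : ℕ}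
    (hU : U ∈ Finset.Icc 1 P.UM) (hpen : net.PenaltyIsBernoulli μ U) :
    net.condCoverage μ τ U = P.coverageFormula τ U := by
  have hU1 := (Finset.mem_Icc.1 hU).1
  have hnn : ∀ j, 0 ≤ P.coverageTerm τ U j := by
    intro j
    have hpm : IsProbabilityMeasure (bernoulliLaw (P.zeta (P.eta j) U)) := by
      rw [← hpen j]
      exact Measure.isProbabilityMeasure_map (h.measurable_penalty j U).aemeasurable
    rw [P.coverageTerm_eq]
    exact mul_nonneg (nonneg_of_isProbabilityMeasure_bernoulliLaw hpm)
      (P.fadingTerm_nonneg j hτ U (h.integrableOn_lossDensity j))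
  rw [condCoverage, measureReal_def, h.cond_streams τ hU,
    h.tsum_measure_linkSNR_of_bernoulli hτ hU1 hpen,
    h.tsum_measure_linkSNR_of_bernoulli hτ hU1 hpen, ← ENNReal.ofReal_add (hnn _) (hnn _),
    ENNReal.toReal_ofReal (add_nonneg (hnn _) (hnn _))]
  rfl

lemma IsModel.coverageFormula_le_of_dominates (h : net.IsModel μ) {τ : ℝ} (hτ : 0 ≤ τ) {U : ℕ}
    (hU : U ∈ Finset.Icc 1 P.UM) (hpen : net.PenaltyDominates μ U) :
    P.coverageFormula τ U ≤ net.condCoverage μ τ U := by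
  have hU1 := (Finset.mem_Icc.1 hU).1
  have : IsProbabilityMeasure (ProbabilityTheory.cond μ {ω | net.streams ω = U}) :=
    cond_isProbabilityMeasure (h.measure_streams_ne_zero hU)
  rw [condCoverage, measureReal_def, ← ENNReal.ofReal_le_iff_le_toReal (measure_ne_top _ _),
    h.cond_streams τ hU]
  -- Subadditivity of `ENNReal.ofReal` needs no sign, so the bound holds even if a coverage term
  -- were negative.
  exact ENNReal.ofReal_add_le.trans (add_le_add
    (h.le_tsum_measure_linkSNR_of_dominates hτ hU1 hpen .LOS)
    (h.le_tsum_measure_linkSNR_of_dominates hτ hU1 hpen .NLOS))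

end Network

end MmWave

end

theorem theorem1 (P : MmWave.Params) {Ω : Type*} [MeasurableSpace Ω] (μ : Measure Ω)
    [IsProbabilityMeasure μ] (net : MmWave.Network P Ω) (hnet : net.IsModel μ)
    (τ : ℝ) (hτ : 0 ≤ τ) :
    -- the tagged base station is almost surely well defined
    (∀ᵐ ω ∂μ, ∃! b, net.IsTagged ω b) ∧
    -- law of the number of streams
    (∀ U, μ.real {ω | net.streams ω = U} = P.streamPMF U) ∧
    -- the coverage is the expectation over the number of streams of the conditional coverage
    net.coverage μ τ = ∫ ω, net.condCoverage μ τ (net.streams ω) ∂μ ∧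
    net.coverage μ τ = ∑ U ∈ Finset.Icc 1 P.UM, P.streamPMF U * net.condCoverage μ τ U ∧
    -- the integrals in the formula converge
    (∀ U ∈ Finset.Icc 1 P.UM, ∀ j, ∀ n ∈ Finset.Icc 1 (P.eta j),
      IntegrableOn (P.integrand τ U j n) (Ioi 0)) ∧
    -- with the Bernoulli penalty the formula is exact
    (∀ U ∈ Finset.Icc 1 P.UM, net.PenaltyIsBernoulli μ U →
      net.condCoverage μ τ U = P.coverageFormula τ U) ∧
    -- with any penalty dominating the Bernoulli penalty the formula is a lower bound
    (∀ U ∈ Finset.Icc 1 P.UM, net.PenaltyDominates μ U →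
      P.coverageFormula τ U ≤ net.condCoverage μ τ U) := by
  have hsum := hnet.measureReal_eq_sum_streams {ω | τ < net.snr ω}
  refine ⟨hnet.ae_isRegular.mono fun ω hω => hω.existsUnique_isTagged, hnet.measureReal_streams,
    ?_, hsum, fun U _ j n _ => P.integrableOn_integrand j hτ U n (hnet.integrableOn_lossDensity j),
    fun U hU hpen => hnet.condCoverage_eq_of_bernoulli hτ hU hpen,
    fun U hU hpen => hnet.coverageFormula_le_of_dominates hτ hU hpen⟩
  rw [hnet.integral_streams fun U => net.condCoverage μ τ U]
  exact hsum
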